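/- For a set $X$ let $\ell_2(X)$ be the Hilbert space of square summable complex families indexed by $X$, with canonical basis $(\delta_x)_{x\in X}$. For a metric space $(X,d)$, the uniform Roe algebra $\mathrm{C}^*_u(X)$ is the norm closure in $\mathcal{B}(\ell_2(X))$ of the $*$-algebra of operators $a$ of finite propagation, i.e. those for which there is $r>0$ such that $\langle a\delta_x,\delta_y\rangle=0$ whenever $d(x,y)>r$. The space $X$ is uniformly locally finite (u.l.f.) if $\sup_{x\in X}|B_r(x)|<\infty$ for all $r>0$. It is sparse if it has a partition $X=\bigsqcup_{n\in\mathbb{N}}X_n$ into finite (possibly empty) sets with $d(X_n,X_m)\to\infty$ as $n+m\to\infty$, $n\neq m$. An operator $a\in\mathcal{B}(\ell_2(X))$ is a ghost if for every $\varepsilon>0$ there is a finite $A\subseteq X$ with $|\langle a\delta_x,\delta_y\rangle|<\varepsilon$ for all $x,y\in X\setminus A$, and $X$ yields only compact ghost projections if every (self-adjoint) projection in $\mathrm{C}^*_u(X)$ that is a ghost is compact. A map $f\colon (X,d)\to(Y,\partial)$ is coarse if $\sup\{\partial(f(x),f(x'))\mid d(x,x')\le r\}<\infty$ for all $r>0$.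 An embedding of $\mathrm{C}^*$-algebras is an injective (not necessarily unital) $*$-homomorphism, and an embedding $\Phi\colon \mathrm{C}^*_u(X)\to\mathrm{C}^*_u(Y)$ is compact preserving if $\Phi(a)$ is compact for every compact $a\in\mathrm{C}^*_u(X)$. **Theorem 1.2.** Let $X$ and $Y$ be u.l.f. metric spaces and assume that every sparse subspace of $Y$ (with the restricted metric) yields only compact ghost projections. (i) If there exists an injective coarse map $X\to Y$, then $\mathrm{C}^*_u(X)$ embeds into $\mathrm{C}^*_u(Y)$. (ii) If $\mathrm{C}^*_u(X)$ embeds into $\mathrm{C}^*_u(Y)$ by a compact preserving map, then there are $k\ge 1$ and a partition $X=\bigsqcup_{n=1}^k X_n$ into (possibly empty) sets such that for every $n\in\{1,\dots,k\}$ there exists an injective coarse map $X_n\to Y$, where $X_n$ carries the restricted metric. -/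

import Mathlib

open scoped InnerProductSpace

noncomputable section

namespace UniformRoe

universe u v

/-- The Hilbert space of square summable complex families indexed by `X`. -/
abbrev L2 (X : Type u) : Type u := lp (fun _ : X => ℂ) 2

open Classical in
/-- The canonical basis vector `δ_x`. -/
def delta {X : Type u} (x : X) : L2 X := lp.single 2 x 1

/-- The bounded operators on `ℓ₂(X)`. -/
abbrev B (X : Type u) : Type u := L2 X →L[ℂ] L2 X

/-- The matrix entry `⟨a δ_x, δ_y⟩`. Mathlib's inner product is linear in the second variable,
hence the order of the arguments below. -/
def entry {X : Type u} (a : B X) (x y : X) : ℂ := ⟪delta y, a (delta x)⟫_ℂ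

/-- `prop(a) ≤ r`: the entries of `a` vanish at pairs of points at distance greater than `r`. -/
def PropagationLE {X : Type u} [MetricSpace X] (a : B X) (r : ℝ) : Prop :=
  ∀ x y : X, r < dist x y → entry a x y = 0

/-- `a` has finite propagation. -/
def FinitePropagation {X : Type u} [MetricSpace X] (a : B X) : Prop :=
  ∃ r : ℝ, 0 < r ∧ PropagationLE a r

theorem inner_delta {X : Type u} (x : X) (v : L2 X) : ⟪delta x, v⟫_ℂ = v x := by
  classical
  have h := lp.inner_single_left (𝕜 := ℂ) (G := fun _ : X => ℂ) x (1 : ℂ) v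
  have e : (delta x : L2 X) = lp.single 2 x (1 : ℂ) := by
    unfold delta; congr
  rw [e, h]; simp

theorem entry_eq {X : Type u} (a : B X) (x y : X) : entry a x y = a (delta x) y :=
  inner_delta y _

theorem entry_star {X : Type u} (a : B X) (x y : X) :
    entry (star a) x y = star (entry a y x) := by
  unfold entry
  rw [ContinuousLinearMap.star_eq_adjoint, ContinuousLinearMap.adjoint_inner_right,
    ← inner_conj_symm]
  rfl

theorem PropagationLE.star {X : Type u} [MetricSpace X] {a : B X} {r : ℝ}
    (h : PropagationLE a r) : PropagationLE (star a) r := by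
  intro x y hxy
  rw [entry_star, h y x (by rwa [dist_comm]), star_zero]

theorem PropagationLE.add {X : Type u} [MetricSpace X] {a b : B X} {r s : ℝ}
    (ha : PropagationLE a r) (hb : PropagationLE b s) : PropagationLE (a + b) (max r s) := by
  intro x y hxy
  have h1 := ha x y (lt_of_le_of_lt (le_max_left _ _) hxy)
  have h2 := hb x y (lt_of_le_of_lt (le_max_right _ _) hxy)
  unfold entry at *
  rw [_root_.add_apply, inner_add_right, h1, h2, add_zero]

theorem PropagationLE.mul {X : Type u} [MetricSpace X] {a b : B X} {r s : ℝ}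
    (ha : PropagationLE a r) (hb : PropagationLE b s) : PropagationLE (a * b) (r + s) := by
  intro x y hxy
  have key : entry (a * b) x y = ⟪(Star.star a) (delta y), b (delta x)⟫_ℂ := by
    unfold entry
    rw [ContinuousLinearMap.star_eq_adjoint, ContinuousLinearMap.adjoint_inner_left]
    rfl
  rw [key, lp.inner_eq_tsum]
  have hz : ∀ z : X, ⟪(Star.star a) (delta y) z, b (delta x) z⟫_ℂ = 0 := by
    intro z
    rw [← entry_eq, ← entry_eq]
    by_cases h : s < dist x z
    · rw [hb x z h, inner_zero_right]
    · have h' : r < dist y z := by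
        have := dist_triangle x z y
        rw [dist_comm y z]
        linarith [not_lt.mp h]
      rw [ha.star y z h', inner_zero_left]
  exact (tsum_congr hz).trans tsum_zero

theorem propagationLE_algebraMap {X : Type u} [MetricSpace X] (c : ℂ) :
    PropagationLE (algebraMap ℂ (B X) c) 1 := by
  classical
  intro x y hxy
  have hne : y ≠ x := by
    rintro rfl
    simp only [dist_self] at hxy
    linarith
  have h0 : (delta x : L2 X) y = 0 := by
    unfold delta
    exact lp.single_apply_ne (E := fun _ : X => ℂ) 2 x (1 : ℂ) hne
  unfold entry
  rw [Algebra.algebraMap_eq_smul_one, _root_.smul_apply,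
    one_apply_eq_self, inner_smul_right, inner_delta, h0, mul_zero]

/-- The `*`-algebra of all operators of finite propagation on `ℓ₂(X)`. -/
def algebraicUniformRoeAlgebra (X : Type u) [MetricSpace X] : StarSubalgebra ℂ (B X) where
  carrier := {a | FinitePropagation a}
  mul_mem' := by
    rintro a b ⟨r, hr, ha⟩ ⟨s, hs, hb⟩
    exact ⟨r + s, add_pos hr hs, ha.mul hb⟩
  add_mem' := by
    rintro a b ⟨r, hr, ha⟩ ⟨s, _, hb⟩
    exact ⟨max r s, lt_max_of_lt_left hr, ha.add hb⟩
  algebraMap_mem' := fun c => ⟨1, one_pos, propagationLE_algebraMap c⟩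
  star_mem' := by
    rintro a ⟨r, hr, ha⟩
    exact ⟨r, hr, ha.star⟩

/-- The uniform Roe algebra `C*_u(X)`: the norm closure of the operators of finite propagation. -/
def uniformRoeAlgebra (X : Type u) [MetricSpace X] : StarSubalgebra ℂ (B X) :=
  (algebraicUniformRoeAlgebra X).topologicalClosure

/-- Uniformly locally finite: for each `r > 0`, the balls of radius `r` have uniformly bounded
finite cardinality. -/
def UniformlyLocallyFinite (X : Type u) [MetricSpace X] : Prop :=
  ∀ r : ℝ, 0 < r → ∃ N : ℕ, ∀ x : X, (Metric.closedBall x r).encard ≤ N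

/-- `X` is sparse: it is a disjoint union of finite sets `X_n`, `n ∈ ℕ`, with
`d(X_n, X_m) → ∞` as `n + m → ∞` over `n ≠ m`. (An empty set is at distance `∞` from all sets.) -/
def Sparse (X : Type u) [MetricSpace X] : Prop :=
  ∃ P : ℕ → Set X,
    (∀ n, (P n).Finite) ∧ Pairwise (fun n m => Disjoint (P n) (P m)) ∧ (⋃ n, P n) = Set.univ ∧
    ∀ R : ℝ, ∃ N : ℕ, ∀ n m : ℕ, n ≠ m → N ≤ n + m →
      ∀ x ∈ P n, ∀ y ∈ P m, R ≤ dist x y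

/-- `a` is a ghost: for each `ε > 0` there is a finite set off which all entries are `< ε`. -/
def IsGhost {X : Type u} (a : B X) : Prop :=
  ∀ ε : ℝ, 0 < ε → ∃ A : Set X, A.Finite ∧ ∀ x y : X, x ∉ A → y ∉ A → ‖entry a x y‖ < ε

/-- Every ghost projection in `C*_u(X)` is compact. -/
def YieldsOnlyCompactGhostProjections (X : Type u) [MetricSpace X] : Prop :=
  ∀ p : B X, p ∈ uniformRoeAlgebra X → IsStarProjection p → IsGhost p → IsCompactOperator p

/-- All sparse subspaces of `Y` (with the restricted metric) yield only compact ghost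
projections. -/
def SparseSubspacesYieldOnlyCompactGhostProjections (Y : Type u) [MetricSpace Y] : Prop :=
  ∀ Z : Set Y, Sparse Z → YieldsOnlyCompactGhostProjections Z

/-- `f` is coarse: `sup {∂(f x, f y) | d(x, y) ≤ r} < ∞` for all `r > 0`. -/
def IsCoarseMap {X : Type u} {Y : Type v} [MetricSpace X] [MetricSpace Y] (f : X → Y) : Prop :=
  ∀ r : ℝ, 0 < r → ∃ R : ℝ, ∀ x y : X, dist x y ≤ r → dist (f x) (f y) ≤ R

/-- `Φ` sends the compact operators of `C*_u(X)` to compact operators. -/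
def CompactPreserving {X : Type u} {Y : Type v} [MetricSpace X] [MetricSpace Y]
    (Φ : uniformRoeAlgebra X →⋆ₙₐ[ℂ] uniformRoeAlgebra Y) : Prop :=
  ∀ a : uniformRoeAlgebra X, IsCompactOperator (a : B X) → IsCompactOperator (Φ a : B Y)

end UniformRoe

end

/-! Part (i) is conjugation by the isometry `δ_x ↦ δ_{f x}`: coarseness of `f` keeps propagation
finite, and compression along `f` is a left inverse.

For (ii), regard the embedding as a representation `ρ` on `ℓ₂(Y)`, and let `e_{xy}` be the matrix
units. The projections `ρ(e_xx)` are nonzero, compact and mutually orthogonal.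

They have uniformly large columns: some `δ > 0` and `f : X → Y` satisfy `‖ρ(e_xx) δ_{f x}‖ ≥ δ`
(`exists_uniform_lower_bound`). Otherwise infinitely many of them, with columns tending to `0`,
almost live on finite sets moving apart. Their sum is a ghost projection of infinite rank, almost
supported on a sparse `Z ⊆ Y`. Its compression to `Z` is nearly idempotent, hence close to a ghost
projection in `C*_u(Z)`, which is compact by hypothesis and yet almost fixes an orthonormal
sequence.

By Bessel's inequality `f` has fibres of bounded size, and compactness of a single `ρ(e_{x₀x₀})`
bounds `⟨ρ(e_{xx'}) δ_{f x'}, δ_{f x}⟩` below after a finite colouring of `X`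
(`exists_coloring_le_entry`). On a piece of the resulting partition `f` is injective. It is also
coarse: if close pairs `x_n, x'_n` had images ever farther apart, the image of the translation `∑
e_{x_n x'_n}` would have large entries arbitrarily far from the diagonal
(`isCoarseMap_of_le_entry`).

Both infinite sums need care because `ρ` may fail to be strongly continuous;
`exists_captured_subseq` restores additivity along a subsequence. -/

noncomputable section

namespace UniformRoe

universe u v w

open Filter Topology

/-! ### Basis vectors, partial translations and matrix units -/

section Basis

variable {ι : Type w} {X : Type u}

open Classical in
theorem delta_apply (x y : X) : (delta x : L2 X) y = if y = x then 1 else 0 := by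
  unfold delta
  split_ifs with h
  · subst h
    exact lp.single_apply_self (E := fun _ : X => ℂ) 2 y (1 : ℂ)
  · exact lp.single_apply_ne (E := fun _ : X => ℂ) 2 x (1 : ℂ) h

theorem orthonormal_delta : Orthonormal ℂ (delta : X → L2 X) := by
  classical
  rw [orthonormal_iff_ite]
  intro x y
  rw [inner_delta, delta_apply]

theorem norm_delta (x : X) : ‖(delta x : L2 X)‖ = 1 := orthonormal_delta.1 x

theorem delta_ne_zero (x : X) : (delta x : L2 X) ≠ 0 := orthonormal_delta.ne_zero x

/-- Bounded operators agreeing on the canonical basis are equal. -/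
theorem ext_delta {a b : B X} (h : ∀ x, a (delta x) = b (delta x)) : a = b := by
  have h2 : star a = star b := by
    ext v y
    rw [← inner_delta, ← inner_delta, ContinuousLinearMap.star_eq_adjoint,
      ContinuousLinearMap.adjoint_inner_right, h, ContinuousLinearMap.star_eq_adjoint,
      ContinuousLinearMap.adjoint_inner_right]
  exact star_injective h2

/-- The isometry `δ_i ↦ δ_{g i}` induced by an injective map `g`. -/
def push (g : ι → X) (hg : Function.Injective g) : L2 ι →ₗᵢ[ℂ] L2 X :=
  (orthonormal_delta.comp g hg).orthogonalFamily.linearIsometry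

theorem push_delta (g : ι → X) (hg : Function.Injective g) (i : ι) :
    push g hg (delta i) = delta (g i) := by
  classical
  have e : (delta i : L2 ι) = lp.single 2 i (1 : ℂ) := by unfold delta; congr
  rw [e]
  refine ((orthonormal_delta.comp g hg).orthogonalFamily.linearIsometry_apply_single _).trans ?_
  simp [LinearIsometry.toSpanSingleton_apply]

/-- `push` as a bounded operator. -/
def pushCLM (g : ι → X) (hg : Function.Injective g) : L2 ι →L[ℂ] L2 X :=
  (push g hg).toContinuousLinearMap

theorem pushCLM_delta (g : ι → X) (hg : Function.Injective g) (i : ι) :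
    pushCLM g hg (delta i) = delta (g i) := push_delta g hg i

theorem norm_pushCLM_apply (g : ι → X) (hg : Function.Injective g) (v : L2 ι) :
    ‖pushCLM g hg v‖ = ‖v‖ := (push g hg).norm_map v

theorem adjoint_pushCLM_apply (g : ι → X) (hg : Function.Injective g) (v : L2 X) (i : ι) :
    (pushCLM g hg).adjoint v i = v (g i) := by
  rw [← inner_delta, ContinuousLinearMap.adjoint_inner_right, pushCLM_delta, inner_delta]

theorem adjoint_pushCLM_delta (g : ι → X) (hg : Function.Injective g) (i : ι) :
    (pushCLM g hg).adjoint (delta (g i)) = delta i := by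
  classical
  ext j
  rw [adjoint_pushCLM_apply, delta_apply, delta_apply]
  simp [hg.eq_iff]

theorem adjoint_pushCLM_delta_of_notMem (g : ι → X) (hg : Function.Injective g) {x : X}
    (hx : x ∉ Set.range g) : (pushCLM g hg).adjoint (delta x) = 0 := by
  classical
  ext j
  rw [adjoint_pushCLM_apply, delta_apply, if_neg]
  · rfl
  · rintro rfl
    exact hx ⟨j, rfl⟩

theorem adjoint_pushCLM_pushCLM (g : ι → X) (hg : Function.Injective g) (v : L2 ι) :
    (pushCLM g hg).adjoint (pushCLM g hg v) = v := by
  have h := (ContinuousLinearMap.norm_map_iff_adjoint_comp_self (pushCLM g hg)).1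
    (norm_pushCLM_apply g hg)
  exact congrArg (fun T => T v) h

/-- The partial isometry `δ_{g' i} ↦ δ_{g i}`, vanishing on the other basis vectors. -/
def transl (g g' : ι → X) (hg : Function.Injective g) (hg' : Function.Injective g') : B X :=
  pushCLM g hg ∘L (pushCLM g' hg').adjoint

theorem transl_delta (g g' : ι → X) (hg : Function.Injective g) (hg' : Function.Injective g')
    (i : ι) : transl g g' hg hg' (delta (g' i)) = delta (g i) := by
  simp [transl, adjoint_pushCLM_delta, pushCLM_delta]

theorem transl_delta_of_notMem (g g' : ι → X) (hg : Function.Injective g)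
    (hg' : Function.Injective g') {x : X} (hx : x ∉ Set.range g') :
    transl g g' hg hg' (delta x) = 0 := by
  simp [transl, adjoint_pushCLM_delta_of_notMem _ _ hx]

theorem star_transl (g g' : ι → X) (hg : Function.Injective g) (hg' : Function.Injective g') :
    star (transl g g' hg hg') = transl g' g hg' hg := by
  rw [ContinuousLinearMap.star_eq_adjoint, transl, ContinuousLinearMap.adjoint_comp,
    ContinuousLinearMap.adjoint_adjoint, transl]

theorem propagationLE_transl [MetricSpace X] (g g' : ι → X) (hg : Function.Injective g)
    (hg' : Function.Injective g') {r : ℝ} (h : ∀ i, dist (g i) (g' i) ≤ r) :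
    PropagationLE (transl g g' hg hg') r := by
  classical
  intro x y hxy
  rw [entry_eq]
  by_cases hx : x ∈ Set.range g'
  · obtain ⟨i, rfl⟩ := hx
    rw [transl_delta, delta_apply, if_neg]
    rintro rfl
    rw [dist_comm] at hxy
    exact absurd (h i) (not_le.2 hxy)
  · rw [transl_delta_of_notMem _ _ _ _ hx]; rfl

theorem PropagationLE.mem_uniformRoeAlgebra [MetricSpace X] {a : B X} {r : ℝ}
    (h : PropagationLE a r) : a ∈ uniformRoeAlgebra X := by
  refine (algebraicUniformRoeAlgebra X).le_topologicalClosure ?_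
  exact ⟨max r 1, by positivity, fun x y hxy => h x y (lt_of_le_of_lt (le_max_left _ _) hxy)⟩

/-- The matrix unit `δ_y ↦ δ_x`. -/
def matrixUnit (x y : X) : B X :=
  transl (fun _ : Unit => x) (fun _ : Unit => y) (Function.injective_of_subsingleton _)
    (Function.injective_of_subsingleton _)

open Classical in
theorem matrixUnit_delta (x y z : X) :
    matrixUnit x y (delta z) = if z = y then delta x else 0 := by
  split_ifs with h
  · subst h
    exact transl_delta (fun _ : Unit => x) (fun _ : Unit => z) _ _ ()
  · exact transl_delta_of_notMem _ _ _ _ (by simpa using h)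

theorem isCompactOperator_matrixUnit (x y : X) : IsCompactOperator (matrixUnit x y) := by
  have h : matrixUnit x y =
      (ContinuousLinearMap.toSpanSingleton ℂ (delta x : L2 X)) ∘L (innerSL ℂ (delta y : L2 X)) := by
    classical
    refine ext_delta fun z => ?_
    rw [matrixUnit_delta]
    simp only [ContinuousLinearMap.comp_apply, innerSL_apply_apply, inner_delta, delta_apply,
      ContinuousLinearMap.toSpanSingleton_apply, eq_comm (a := y)]
    split_ifs <;> simp
  rw [h]
  exact IsCompactOperator.comp_clm (f := ContinuousLinearMap.toSpanSingleton ℂ (delta x : L2 X))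
    (isCompactOperator_of_locallyCompactSpace_rng _) _

/-- Multiplication by the indicator function of `A`. -/
def chi (A : Set X) : B X :=
  transl (Subtype.val : A → X) Subtype.val Subtype.val_injective Subtype.val_injective

open Classical in
theorem chi_delta (A : Set X) (z : X) : chi A (delta z) = if z ∈ A then delta z else 0 := by
  split_ifs with h
  · exact transl_delta (Subtype.val : A → X) Subtype.val _ _ ⟨z, h⟩
  · exact transl_delta_of_notMem _ _ _ _ (by simpa using h)

theorem star_chi (A : Set X) : star (chi A) = chi A := star_transl _ _ _ _

open Classical in
theorem chi_apply (A : Set X) (v : L2 X) (x : X) : chi A v x = if x ∈ A then v x else 0 := by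
  rw [← inner_delta, ← star_chi, ContinuousLinearMap.star_eq_adjoint,
    ContinuousLinearMap.adjoint_inner_right, chi_delta]
  split_ifs
  · rw [inner_delta]
  · rw [inner_zero_left]

theorem chi_mul_chi (A A' : Set X) : chi A * chi A' = chi (A ∩ A') := by
  classical
  refine ext_delta fun z => ?_
  simp only [mul_apply_eq_comp, chi_delta, Set.mem_inter_iff]
  split_ifs <;> simp_all [chi_delta]

theorem chi_empty : chi (∅ : Set X) = 0 := by
  classical
  exact ext_delta fun z => by simp [chi_delta]

theorem chi_insert {A : Set X} {x : X} (hx : x ∉ A) :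
    chi (insert x A) = matrixUnit x x + chi A := by
  classical
  refine ext_delta fun z => ?_
  simp only [_root_.add_apply, chi_delta, matrixUnit_delta, Set.mem_insert_iff]
  split_ifs <;> simp_all

theorem matrixUnit_mul_matrixUnit (x y z : X) :
    matrixUnit x y * matrixUnit y z = matrixUnit x z := by
  classical
  refine ext_delta fun w => ?_
  simp only [mul_apply_eq_comp, matrixUnit_delta]
  split_ifs <;> simp [matrixUnit_delta]

theorem star_matrixUnit (x y : X) : star (matrixUnit x y) = matrixUnit y x := star_transl _ _ _ _

theorem matrixUnit_self (x : X) : matrixUnit x x = chi {x} := by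
  classical
  refine ext_delta fun w => ?_
  simp only [chi_delta, matrixUnit_delta, Set.mem_singleton_iff]
  split_ifs <;> simp_all

theorem chi_range_mul_transl (g g' : ι → X) (hg : Function.Injective g)
    (hg' : Function.Injective g') :
    chi (Set.range g) * transl g g' hg hg' = transl g g' hg hg' := by
  refine ext_delta fun z => ?_
  by_cases hz : z ∈ Set.range g'
  · obtain ⟨i, rfl⟩ := hz
    simp [transl_delta, chi_delta]
  · simp [transl_delta_of_notMem _ _ _ _ hz]

theorem matrixUnit_mul_transl (g g' : ι → X) (hg : Function.Injective g)
    (hg' : Function.Injective g') (i : ι) :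
    matrixUnit (g i) (g i) * transl g g' hg hg' = matrixUnit (g i) (g' i) := by
  classical
  refine ext_delta fun z => ?_
  by_cases hz : z ∈ Set.range g'
  · obtain ⟨j, rfl⟩ := hz
    simp [transl_delta, matrixUnit_delta, hg.eq_iff, hg'.eq_iff]
  · rw [mul_apply_eq_comp, transl_delta_of_notMem _ _ _ _ hz, matrixUnit_delta,
      if_neg, map_zero]
    rintro rfl
    exact hz ⟨i, rfl⟩

theorem norm_chi_apply_le (A : Set X) (v : L2 X) : ‖chi A v‖ ≤ ‖v‖ := by
  have h : ‖(pushCLM (Subtype.val : A → X) Subtype.val_injective).adjoint v‖ ≤ ‖v‖ := by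
    refine (ContinuousLinearMap.le_opNorm _ v).trans ?_
    have : ‖(pushCLM (Subtype.val : A → X) Subtype.val_injective).adjoint‖ ≤ 1 := by
      rw [LinearIsometryEquiv.norm_map]
      exact LinearIsometry.norm_toContinuousLinearMap_le _
    nlinarith [norm_nonneg v]
  rw [chi, transl, ContinuousLinearMap.comp_apply, norm_pushCLM_apply]
  exact h

end Basis

/-! ### Matrix units inside the uniform Roe algebra -/

section Roe

variable {X : Type u} [MetricSpace X]

/-- `matrixUnit x y` as an element of the uniform Roe algebra. -/
def roeUnit (x y : X) : uniformRoeAlgebra X :=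
  ⟨matrixUnit x y, (propagationLE_transl _ _ _ _ fun _ => le_rfl).mem_uniformRoeAlgebra⟩

/-- `chi A` as an element of the uniform Roe algebra. -/
def roeChi (A : Set X) : uniformRoeAlgebra X :=
  ⟨chi A, (propagationLE_transl _ _ _ _
    (fun i : A => (dist_self (i : X)).le)).mem_uniformRoeAlgebra⟩

theorem roeUnit_mul_roeUnit (x y z : X) : roeUnit x y * roeUnit y z = roeUnit x z :=
  Subtype.ext (matrixUnit_mul_matrixUnit x y z)

theorem star_roeUnit (x y : X) : star (roeUnit x y) = roeUnit y x :=
  Subtype.ext (star_matrixUnit x y)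

theorem roeUnit_self (x : X) : roeUnit x x = roeChi {x} := Subtype.ext (matrixUnit_self x)

theorem roeChi_mul_roeChi (A A' : Set X) : roeChi A * roeChi A' = roeChi (A ∩ A') :=
  Subtype.ext (chi_mul_chi A A')

theorem star_roeChi (A : Set X) : star (roeChi A) = roeChi A := Subtype.ext (star_chi A)

theorem roeChi_empty : roeChi (∅ : Set X) = 0 := Subtype.ext chi_empty

theorem roeChi_insert {A : Set X} {x : X} (hx : x ∉ A) :
    roeChi (insert x A) = roeUnit x x + roeChi A := Subtype.ext (chi_insert hx)

theorem roeUnit_ne_zero (x y : X) : roeUnit x y ≠ 0 := by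
  classical
  intro h
  have h2 : matrixUnit x y (delta y) = 0 := by
    rw [show matrixUnit x y = 0 from congrArg Subtype.val h]; rfl
  rw [matrixUnit_delta, if_pos rfl] at h2
  exact delta_ne_zero x h2

end Roe

/-! ### Countability of u.l.f. spaces -/

section Countability

variable {X : Type u} [MetricSpace X]

theorem UniformlyLocallyFinite.finite_closedBall (h : UniformlyLocallyFinite X) (x : X) (r : ℝ) :
    (Metric.closedBall x r).Finite := by
  obtain ⟨N, hN⟩ := h (max r 1) (by positivity)
  refine Set.Finite.subset (Set.finite_of_encard_le_coe (hN x)) ?_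
  exact Metric.closedBall_subset_closedBall (le_max_left _ _)

theorem UniformlyLocallyFinite.countable (h : UniformlyLocallyFinite X) : Countable X := by
  rcases isEmpty_or_nonempty X with h0 | ⟨⟨x⟩⟩
  · infer_instance
  · rw [← Set.countable_univ_iff, ← Metric.iUnion_closedBall_nat x]
    exact Set.countable_iUnion fun n => (h.finite_closedBall x n).countable

end Countability

/-! ### Coordinate truncations and compact operators -/

section CompactOperators

variable {Y : Type v}

theorem norm_coord_le (v : L2 Y) (y : Y) : ‖v y‖ ≤ ‖v‖ :=
  lp.norm_apply_le_norm two_ne_zero v y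

theorem tendsto_chi_apply (c : L2 Y) :
    Tendsto (fun F : Finset Y => chi (F : Set Y) c) atTop (𝓝 c) := by
  classical
  have h := lp.hasSum_single (E := fun _ : Y => ℂ) (p := 2) (by norm_num) c
  refine Tendsto.congr (fun F => ?_) h
  ext y
  rw [chi_apply, lp.coeFn_sum, Finset.sum_apply]
  simp only [Finset.mem_coe]
  split_ifs with hy
  · rw [Finset.sum_eq_single y]
    · exact lp.single_apply_self (E := fun _ : Y => ℂ) 2 y (c y)
    · intro z _ hz
      exact lp.single_apply_ne (E := fun _ : Y => ℂ) 2 z (c z) hz.symm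
    · exact fun h => absurd hy h
  · refine Finset.sum_eq_zero fun z hz => ?_
    refine lp.single_apply_ne (E := fun _ : Y => ℂ) 2 z (c z) ?_
    rintro rfl
    exact hy hz

theorem chi_compl_apply (A : Set Y) (u : L2 Y) : chi Aᶜ u = u - chi A u := by
  classical
  ext y
  rw [lp.coeFn_sub, Pi.sub_apply, chi_apply, chi_apply]
  simp only [Set.mem_compl_iff]
  split_ifs <;> simp_all

theorem chi_chi_apply (A A' : Set Y) (u : L2 Y) : chi A (chi A' u) = chi (A ∩ A') u := by
  rw [← mul_apply_eq_comp, chi_mul_chi]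

theorem norm_chi_apply_mono {A A' : Set Y} (h : A ⊆ A') (u : L2 Y) :
    ‖chi A u‖ ≤ ‖chi A' u‖ := by
  have := norm_chi_apply_le A (chi A' u)
  rwa [chi_chi_apply, Set.inter_eq_left.2 h] at this

theorem norm_chi_union_apply_le (A A' : Set Y) (u : L2 Y) :
    ‖chi (A ∪ A') u‖ ≤ ‖chi A u‖ + ‖chi A' u‖ := by
  have h : chi (A ∪ A') u = chi A u + chi (A' \ A) u := by
    classical
    ext y
    rw [lp.coeFn_add, Pi.add_apply, chi_apply, chi_apply, chi_apply]
    simp only [Set.mem_union, Set.mem_sdiff]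
    split_ifs <;> simp_all
  rw [h]
  exact (norm_add_le _ _).trans (by gcongr; exact norm_chi_apply_mono Set.sdiff_subset u)

/-- A compact operator is approximated in norm by its finite row truncations. -/
theorem exists_finset_norm_chi_compl_le {K : B Y} (hK : IsCompactOperator K) {ε : ℝ}
    (hε : 0 < ε) : ∃ F : Finset Y, ∀ v, ‖chi (F : Set Y)ᶜ (K v)‖ ≤ ε * ‖v‖ := by
  simp only [chi_compl_apply]
  have htb : TotallyBounded (K '' Metric.closedBall 0 1) :=
    (IsCompactOperator.isCompact_closure_image_closedBall (f := (K : L2 Y →ₗ[ℂ] L2 Y))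
      hK 1).totallyBounded.subset subset_closure
  obtain ⟨t, ht, hcov⟩ := Metric.totallyBounded_iff.1 htb (ε / 3) (by positivity)
  have hev : ∀ᶠ F : Finset Y in atTop, ∀ c ∈ t, ‖c - chi (F : Set Y) c‖ < ε / 3 := by
    rw [eventually_all_finite ht]
    intro c _
    have := (tendsto_chi_apply c).eventually (Metric.ball_mem_nhds c (by positivity : 0 < ε / 3))
    filter_upwards [this] with F hF
    rwa [← dist_eq_norm, dist_comm]
  obtain ⟨F, hF⟩ := hev.exists
  have unit : ∀ v, ‖v‖ ≤ 1 → ‖K v - chi (F : Set Y) (K v)‖ ≤ ε := by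
    intro v hv
    have hm := hcov ⟨v, by simpa using hv, rfl⟩
    simp only [Set.mem_iUnion, Metric.mem_ball, exists_prop] at hm
    obtain ⟨c, hc, hvc⟩ := hm
    rw [dist_eq_norm] at hvc
    have e : K v - chi (F : Set Y) (K v)
        = (K v - c) + (c - chi (F : Set Y) c) - chi (F : Set Y) (K v - c) := by
      rw [map_sub]; abel
    rw [e]
    have h1 := norm_sub_le ((K v - c) + (c - chi (F : Set Y) c)) (chi (F : Set Y) (K v - c))
    have h2 := norm_add_le (K v - c) (c - chi (F : Set Y) c)
    have h3 := norm_chi_apply_le (F : Set Y) (K v - c)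
    have h4 := hF c hc
    linarith
  refine ⟨F, fun v => ?_⟩
  have hop : ‖K - chi (F : Set Y) * K‖ ≤ ε := by
    refine ContinuousLinearMap.opNorm_le_of_unit_norm hε.le fun v hv => ?_
    exact unit v hv.le
  exact ContinuousLinearMap.le_of_opNorm_le _ hop v

end CompactOperators

/-! ### Representations of the Roe algebra and strong sums -/

section Representation

variable {X : Type u} {Y : Type v} [MetricSpace X]
  (ρ : uniformRoeAlgebra X →⋆ₙₐ[ℂ] B Y)

theorem inner_map_map (a b : uniformRoeAlgebra X) (v w : L2 Y) :
    ⟪ρ a v, ρ b w⟫_ℂ = ⟪v, ρ (star a * b) w⟫_ℂ := by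
  rw [map_mul, map_star, ContinuousLinearMap.star_eq_adjoint, mul_apply_eq_comp,
    ContinuousLinearMap.adjoint_inner_right]

theorem norm_sq_map_apply (a : uniformRoeAlgebra X) (v : L2 Y) :
    ‖ρ a v‖ ^ 2 = RCLike.re ⟪v, ρ (star a * a) v⟫_ℂ := by
  rw [← inner_map_map, inner_self_eq_norm_sq]

/-- `ρ(e_yx)` is a partial isometry with initial projection `ρ(e_xx)`. -/
theorem norm_map_roeUnit (x y : X) (v : L2 Y) :
    ‖ρ (roeUnit y x) v‖ = ‖ρ (roeUnit x x) v‖ := by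
  rw [← sq_eq_sq₀ (norm_nonneg _) (norm_nonneg _), norm_sq_map_apply, norm_sq_map_apply,
    star_roeUnit, star_roeUnit, roeUnit_mul_roeUnit, roeUnit_mul_roeUnit]

theorem norm_sq_map_roeChi (A : Set X) (v : L2 Y) :
    ‖ρ (roeChi A) v‖ ^ 2 = RCLike.re ⟪v, ρ (roeChi A) v⟫_ℂ := by
  rw [norm_sq_map_apply, star_roeChi, roeChi_mul_roeChi, Set.inter_self]

theorem norm_map_roeChi_le (A : Set X) (v : L2 Y) : ‖ρ (roeChi A) v‖ ≤ ‖v‖ := by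
  have h := norm_sq_map_roeChi ρ A v
  have h2 := re_inner_le_norm (𝕜 := ℂ) v (ρ (roeChi A) v)
  by_contra! h3
  nlinarith [norm_nonneg v]

theorem norm_map_roeUnit_self_le (x : X) (v : L2 Y) : ‖ρ (roeUnit x x) v‖ ≤ ‖v‖ := by
  rw [roeUnit_self]
  exact norm_map_roeChi_le ρ _ v

theorem map_roeChi_finset (S : Finset X) (v : L2 Y) :
    ρ (roeChi (S : Set X)) v = ∑ x ∈ S, ρ (roeUnit x x) v := by
  classical
  induction S using Finset.induction_on with
  | empty => simp [roeChi_empty]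
  | insert x S hx ih =>
    rw [Finset.coe_insert, roeChi_insert (by simpa using hx), map_add, _root_.add_apply, ih,
      Finset.sum_insert hx]

theorem norm_sq_sum_map_roeUnit (S : Finset X) (v : L2 Y) :
    ‖∑ x ∈ S, ρ (roeUnit x x) v‖ ^ 2 = ∑ x ∈ S, ‖ρ (roeUnit x x) v‖ ^ 2 := by
  rw [← map_roeChi_finset, norm_sq_map_roeChi, map_roeChi_finset, inner_sum, map_sum]
  refine Finset.sum_congr rfl fun x _ => ?_
  rw [roeUnit_self, norm_sq_map_roeChi]

theorem sum_norm_sq_map_roeUnit_le (S : Finset X) (v : L2 Y) :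
    ∑ x ∈ S, ‖ρ (roeUnit x x) v‖ ^ 2 ≤ ‖v‖ ^ 2 := by
  rw [← norm_sq_sum_map_roeUnit, ← map_roeChi_finset]
  gcongr
  exact norm_map_roeChi_le ρ _ v

theorem summable_norm_sq_map_roeUnit (v : L2 Y) :
    Summable fun x => ‖ρ (roeUnit x x) v‖ ^ 2 :=
  summable_of_sum_le (fun _ => sq_nonneg _) fun S => sum_norm_sq_map_roeUnit_le ρ S v

theorem tendsto_norm_map_roeUnit (v : L2 Y) :
    Tendsto (fun x => ‖ρ (roeUnit x x) v‖) cofinite (𝓝 0) := by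
  simpa [Real.sqrt_sq] using (summable_norm_sq_map_roeUnit ρ v).tendsto_cofinite_zero.sqrt

theorem summable_map_roeUnit (v : L2 Y) : Summable fun x => ρ (roeUnit x x) v := by
  rw [summable_iff_vanishing_norm]
  intro ε hε
  obtain ⟨s, hs⟩ := (summable_iff_vanishing_norm.1 (summable_norm_sq_map_roeUnit ρ v)) (ε ^ 2)
    (by positivity)
  refine ⟨s, fun t ht => ?_⟩
  have h := hs t ht
  rw [← norm_sq_sum_map_roeUnit, Real.norm_of_nonneg (sq_nonneg _)] at h
  exact lt_of_pow_lt_pow_left₀ 2 hε.le h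

/-- `ρ (χ_A)` vanishes on the vectors killed by all diagonal matrix units. -/
def Captured (A : Set X) : Prop :=
  ∀ v : L2 Y, (∀ x, ρ (roeUnit x x) v = 0) → ρ (roeChi A) v = 0

variable {ρ}

/-- In general `ρ(χ_A)` may be strictly larger than the strong sum of the `ρ(e_xx)`. The difference
of the two at `v` is killed by every `ρ(e_xx)`, so capturedness forces it to vanish. -/
theorem Captured.hasSum {ι : Type w} {g : ι → X} (hg : Function.Injective g)
    (h : Captured ρ (Set.range g)) (v : L2 Y) :
    HasSum (fun i => ρ (roeUnit (g i) (g i)) v) (ρ (roeChi (Set.range g)) v) := by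
  classical
  have hs : Summable fun i => ρ (roeUnit (g i) (g i)) v :=
    (summable_map_roeUnit ρ v).comp_injective hg
  convert hs.hasSum using 1
  set T := ∑' i, ρ (roeUnit (g i) (g i)) v with hT
  have mulT : ∀ a : uniformRoeAlgebra X,
      HasSum (fun i => ρ (a * roeUnit (g i) (g i)) v) (ρ a T) := by
    intro a
    have := hs.hasSum.mapL (ρ a)
    simpa only [map_mul, mul_apply_eq_comp] using this
  have key : ∀ x, ρ (roeUnit x x) (ρ (roeChi (Set.range g)) v - T) = 0 := by
    intro x
    rw [map_sub, sub_eq_zero, ← mul_apply_eq_comp, ← map_mul, roeUnit_self, roeChi_mul_roeChi]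
    have h1 := mulT (roeChi {x})
    by_cases hx : x ∈ Set.range g
    · obtain ⟨i, rfl⟩ := hx
      have h2 : HasSum (fun j => ρ (roeChi {g i} * roeUnit (g j) (g j)) v)
          (ρ (roeChi {g i} * roeUnit (g i) (g i)) v) := by
        refine hasSum_single i fun j hj => ?_
        rw [roeUnit_self, roeChi_mul_roeChi, Set.singleton_inter_eq_empty.2, roeChi_empty, map_zero,
          _root_.zero_apply]
        simpa [hg.eq_iff] using hj.symm
      rw [h1.unique h2, roeUnit_self, roeChi_mul_roeChi, Set.inter_self,
        Set.inter_eq_left.2 (by simp)]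
    · have h2 : ∀ j, ρ (roeChi {x} * roeUnit (g j) (g j)) v = 0 := by
        intro j
        rw [roeUnit_self, roeChi_mul_roeChi, Set.singleton_inter_eq_empty.2, roeChi_empty, map_zero,
          _root_.zero_apply]
        rintro rfl
        exact hx ⟨j, rfl⟩
      simp only [h2] at h1
      rw [h1.unique hasSum_zero, Set.singleton_inter_eq_empty.2 hx, roeChi_empty, map_zero,
        _root_.zero_apply]
  have h0 := h _ key
  have h1 : ρ (roeChi (Set.range g)) T = T := by
    refine (mulT _).unique ?_
    convert hs.hasSum using 4 with i
    rw [roeUnit_self, roeChi_mul_roeChi, Set.inter_eq_right.2 (by simp)]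
  rwa [map_sub, ← mul_apply_eq_comp, ← map_mul, roeChi_mul_roeChi, Set.inter_self, h1,
    sub_eq_zero] at h0

/-- There is an uncountable almost disjoint family of infinite sets of natural numbers. -/
theorem exists_almostDisjoint : ∃ M : (ℕ → Bool) → Set ℕ, (∀ t, (M t).Infinite) ∧
    ∀ t s, t ≠ s → (M t ∩ M s).Finite := by
  -- Branches of the binary tree, coded by their finite prefixes: distinct branches share only the
  -- prefixes before they split.
  let c : (ℕ → Bool) → ℕ → ℕ := fun t n => Encodable.encode (List.ofFn fun i : Fin n => t i)
  have hlen : ∀ t s n m, c t n = c s m → n = m ∧ ∀ i < n, t i = s i := by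
    intro t s n m h
    have h1 := Encodable.encode_injective h
    have h2 := congrArg List.length h1
    simp only [List.length_ofFn] at h2
    subst h2
    have h3 := List.ofFn_injective h1
    exact ⟨rfl, fun i hi => congrFun h3 ⟨i, hi⟩⟩
  refine ⟨fun t => Set.range (c t), fun t => ?_, fun t s hts => ?_⟩
  · exact Set.infinite_range_of_injective fun n m h => (hlen t t n m h).1
  · obtain ⟨i, hi⟩ := Function.ne_iff.1 hts
    refine ((Set.finite_Iic i).image (c t)).subset ?_
    rintro _ ⟨⟨n, rfl⟩, m, hm⟩
    refine ⟨n, ?_, rfl⟩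
    by_contra hn
    rw [Set.mem_Iic, not_le] at hn
    exact hi ((hlen t s n m hm.symm).2 i hn)

/-- Every sequence of distinct points has a subsequence whose range is captured by `ρ`. -/
theorem exists_captured_subseq [Countable Y] (ρ : uniformRoeAlgebra X →⋆ₙₐ[ℂ] B Y) {g : ℕ → X}
    (hg : Function.Injective g) :
    ∃ φ : ℕ → ℕ, StrictMono φ ∧ Captured ρ (Set.range (g ∘ φ)) := by
  classical
  obtain ⟨M, hM, hMd⟩ := exists_almostDisjoint
  suffices h : ∃ t, Captured ρ (g '' M t) by
    obtain ⟨t, ht⟩ := h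
    have := (hM t).to_subtype
    refine ⟨Nat.orderEmbeddingOfSet (M t), (Nat.orderEmbeddingOfSet (M t)).strictMono, ?_⟩
    rwa [Set.range_comp, Nat.orderEmbeddingOfSet_range]
  by_contra! hcon
  simp only [Captured, not_forall] at hcon
  choose v hv hv0 using hcon
  -- If every set fails, each gives a nonzero vector. Distinct ones are orthogonal, since the sets
  -- meet in a finite set and finite sums of the `ρ(e_xx)` kill `v s`.
  let w : (ℕ → Bool) → L2 Y := fun t => ρ (roeChi (g '' M t)) (v t)
  have hw0 : ∀ t, w t ≠ 0 := hv0
  have hwo : ∀ t s, t ≠ s → ⟪w t, w s⟫_ℂ = 0 := by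
    intro t s hts
    have hfin : (g '' M t ∩ g '' M s).Finite := by
      rw [← Set.image_inter hg]
      exact (hMd t s hts).image g
    have h := inner_map_map ρ (roeChi (g '' M t)) (roeChi (g '' M s)) (v t) (v s)
    rw [star_roeChi, roeChi_mul_roeChi, ← hfin.coe_toFinset, map_roeChi_finset,
      Finset.sum_eq_zero fun x _ => hv s x, inner_zero_right] at h
    exact h
  have hon : Orthonormal ℂ fun t => ((‖w t‖⁻¹ : ℝ) : ℂ) • w t := by
    refine ⟨fun t => ?_, fun t s hts => ?_⟩
    · rw [norm_smul, Complex.norm_real, norm_inv, norm_norm,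
        inv_mul_cancel₀ (norm_ne_zero_iff.2 (hw0 t))]
    · simp only
      rw [inner_smul_left, inner_smul_right, hwo t s hts, mul_zero, mul_zero]
  -- By Bessel, each of the countably many `δ_y` meets only countably many members of the
  -- orthonormal family, which is uncountable.
  have hc : ∀ y : Y, (Function.support
      fun t => ‖⟪((‖w t‖⁻¹ : ℝ) : ℂ) • w t, delta y⟫_ℂ‖ ^ 2).Countable :=
    fun y => (hon.inner_products_summable (delta y)).countable_support
  have huniv : (⋃ y : Y, Function.support
      fun t => ‖⟪((‖w t‖⁻¹ : ℝ) : ℂ) • w t, delta y⟫_ℂ‖ ^ 2) = Set.univ := by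
    rw [Set.eq_univ_iff_forall]
    intro t
    have : ∃ y, w t y ≠ 0 := by
      by_contra! h
      exact hw0 t (lp.ext (funext h))
    obtain ⟨y, hy⟩ := this
    rw [Set.mem_iUnion]
    refine ⟨y, ?_⟩
    rw [Function.mem_support, inner_smul_left, ← inner_conj_symm, inner_delta]
    simpa [hw0 t] using hy
  have : (Set.univ : Set (ℕ → Bool)).Countable := huniv ▸ Set.countable_iUnion hc
  rw [Set.countable_univ_iff, ← Cardinal.mk_le_aleph0_iff] at this
  simp only [Cardinal.mk_pi, Cardinal.mk_bool, Cardinal.prod_const, Cardinal.mk_nat,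
    Cardinal.lift_id] at this
  exact absurd this (not_le.2 (by simpa using Cardinal.cantor Cardinal.aleph0))

/-- For a projection, Cauchy–Schwarz bounds the coordinate at `y` of any image vector by the norm of
the column at `y`. -/
theorem norm_chi_finset_map_roeUnit_le (H : Finset Y) (x : X) (v : L2 Y) :
    ‖chi (H : Set Y) (ρ (roeUnit x x) v)‖ ≤ (∑ y ∈ H, ‖ρ (roeUnit x x) (delta y)‖) * ‖v‖ := by
  classical
  have e : chi (H : Set Y) (ρ (roeUnit x x) v) = ∑ y ∈ H, (ρ (roeUnit x x) v) y • delta y := by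
    ext w
    simp only [lp.coeFn_sum, Finset.sum_apply, lp.coeFn_smul, Pi.smul_apply, delta_apply,
      smul_eq_mul, mul_ite, mul_one, mul_zero]
    rw [Finset.sum_ite_eq, chi_apply]
    simp only [Finset.mem_coe]
  rw [e, Finset.sum_mul]
  refine (norm_sum_le _ _).trans (Finset.sum_le_sum fun y _ => ?_)
  rw [norm_smul, norm_delta, mul_one, ← inner_delta]
  have h := inner_map_map ρ (roeUnit x x) (roeUnit x x) (delta y) v
  rw [star_roeUnit, roeUnit_mul_roeUnit] at h
  rw [← h]
  refine (norm_inner_le_norm _ _).trans ?_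
  gcongr
  exact norm_map_roeUnit_self_le ρ x v

/-- The squared norm of a column of a projection is its diagonal entry, which compactness makes
small off a finite set. -/
theorem tendsto_norm_map_roeUnit_delta {x : X} (h : IsCompactOperator (ρ (roeUnit x x))) :
    Tendsto (fun y => ‖ρ (roeUnit x x) (delta y)‖) cofinite (𝓝 0) := by
  classical
  rw [Metric.tendsto_nhds]
  intro ε hε
  obtain ⟨F, hF⟩ := exists_finset_norm_chi_compl_le h (show 0 < (ε / 2) ^ 2 by positivity)
  have : ∀ y, y ∉ F → dist ‖ρ (roeUnit x x) (delta y)‖ 0 < ε := by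
    intro y hy
    have h1 := hF (delta y)
    rw [norm_delta, mul_one] at h1
    have h2 := (norm_coord_le _ y).trans h1
    rw [chi_apply, if_pos (by simpa using hy), ← inner_delta] at h2
    have h3 := norm_sq_map_roeChi ρ {x} (delta y)
    rw [← roeUnit_self] at h3
    have h4 := (RCLike.re_le_norm _).trans h2
    rw [← h3] at h4
    have h5 := le_of_sq_le_sq h4 (by positivity)
    rw [Real.dist_0_eq_abs, abs_norm]
    linarith
  refine (Finset.finite_toSet F).subset fun y hy => ?_
  by_contra hyF
  exact hy (this y hyF)

end Representation

/-! ### Compression and extension along injections; part (i) -/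

section Conjugation

variable {X : Type u} {Y : Type v}

theorem norm_entry_le (a : B X) (x y : X) : ‖entry a x y‖ ≤ ‖a‖ := by
  rw [entry_eq]
  refine (norm_coord_le _ y).trans ?_
  simpa [norm_delta] using a.le_opNorm (delta x)

theorem entry_sub (a b : B X) (x y : X) : entry (a - b) x y = entry a x y - entry b x y := by
  simp only [entry_eq]
  rfl

theorem norm_adjoint_pushCLM_apply_le (f : X → Y) (hf : Function.Injective f) (v : L2 Y) :
    ‖(pushCLM f hf).adjoint v‖ ≤ ‖v‖ := by
  refine (ContinuousLinearMap.le_opNorm _ v).trans ?_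
  have : ‖(pushCLM f hf).adjoint‖ ≤ 1 := by
    rw [LinearIsometryEquiv.norm_map]
    exact LinearIsometry.norm_toContinuousLinearMap_le _
  nlinarith [norm_nonneg v]

/-- The compression of an operator along an injective map. -/
def compress (f : X → Y) (hf : Function.Injective f) (b : B Y) : B X :=
  (pushCLM f hf).adjoint ∘L b ∘L pushCLM f hf

theorem entry_compress (f : X → Y) (hf : Function.Injective f) (b : B Y) (x x' : X) :
    entry (compress f hf b) x x' = entry b (f x) (f x') := by
  rw [entry_eq, entry_eq, compress, ContinuousLinearMap.comp_apply, adjoint_pushCLM_apply,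
    ContinuousLinearMap.comp_apply, pushCLM_delta]

theorem continuous_compress (f : X → Y) (hf : Function.Injective f) :
    Continuous (compress f hf) := by
  unfold compress
  fun_prop

/-- The extension by zero of an operator along an injective map. -/
def extend (f : X → Y) (hf : Function.Injective f) (a : B X) : B Y :=
  pushCLM f hf ∘L a ∘L (pushCLM f hf).adjoint

theorem entry_extend (f : X → Y) (hf : Function.Injective f) (a : B X) (x x' : X) :
    entry (extend f hf a) (f x) (f x') = entry a x x' := by
  rw [entry, extend, ContinuousLinearMap.comp_apply, ContinuousLinearMap.comp_apply,
    adjoint_pushCLM_delta, ← ContinuousLinearMap.adjoint_inner_left, adjoint_pushCLM_delta, entry]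

theorem entry_extend_of_notMem_left (f : X → Y) (hf : Function.Injective f) (a : B X) {y : Y}
    (y' : Y) (hy : y ∉ Set.range f) : entry (extend f hf a) y y' = 0 := by
  rw [entry, extend, ContinuousLinearMap.comp_apply, ContinuousLinearMap.comp_apply,
    adjoint_pushCLM_delta_of_notMem _ _ hy, map_zero, map_zero, inner_zero_right]

theorem entry_extend_of_notMem_right (f : X → Y) (hf : Function.Injective f) (a : B X) (y : Y)
    {y' : Y} (hy : y' ∉ Set.range f) : entry (extend f hf a) y y' = 0 := by
  rw [entry, extend, ContinuousLinearMap.comp_apply, ← ContinuousLinearMap.adjoint_inner_left,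
    adjoint_pushCLM_delta_of_notMem _ _ hy, inner_zero_left]

theorem compress_extend (f : X → Y) (hf : Function.Injective f) (a : B X) :
    compress f hf (extend f hf a) = a := by
  ext v : 1
  simp [compress, extend, adjoint_pushCLM_pushCLM]

theorem extend_mul (f : X → Y) (hf : Function.Injective f) (a b : B X) :
    extend f hf (a * b) = extend f hf a * extend f hf b := by
  ext v : 1
  simp [extend, adjoint_pushCLM_pushCLM]

theorem extend_star (f : X → Y) (hf : Function.Injective f) (a : B X) :
    extend f hf (star a) = star (extend f hf a) := by
  simp [extend, ContinuousLinearMap.star_eq_adjoint, ContinuousLinearMap.adjoint_comp,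
    ContinuousLinearMap.comp_assoc]

/-- `extend` as a `*`-homomorphism. -/
def extendHom (f : X → Y) (hf : Function.Injective f) : B X →⋆ₙₐ[ℂ] B Y where
  toFun := extend f hf
  map_smul' c a := by ext v : 1; simp [extend]
  map_zero' := by ext v : 1; simp [extend]
  map_add' a b := by ext v : 1; simp [extend]
  map_mul' := extend_mul f hf
  map_star' := extend_star f hf

theorem continuous_extend (f : X → Y) (hf : Function.Injective f) : Continuous (extend f hf) := by
  unfold extend
  fun_prop

variable [MetricSpace X] [MetricSpace Y]

theorem compress_mem {Z : Set Y} {b : B Y} (hb : b ∈ uniformRoeAlgebra Y) :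
    compress (Subtype.val : Z → Y) Subtype.val_injective b ∈ uniformRoeAlgebra Z := by
  refine map_mem_closure (continuous_compress _ _) hb ?_
  rintro b ⟨r, hr, hb⟩
  refine ⟨r, hr, fun x y hxy => ?_⟩
  rw [entry_compress]
  exact hb _ _ hxy

theorem extend_mem {f : X → Y} (hf : Function.Injective f) (hc : IsCoarseMap f) {a : B X}
    (ha : a ∈ uniformRoeAlgebra X) : extend f hf a ∈ uniformRoeAlgebra Y := by
  refine map_mem_closure (continuous_extend _ _) ha ?_
  rintro a ⟨r, hr, ha⟩
  obtain ⟨R, hR⟩ := hc r hr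
  refine ⟨max R 1, by positivity, fun y y' hyy => ?_⟩
  by_cases hy : y ∈ Set.range f
  · by_cases hy' : y' ∈ Set.range f
    · obtain ⟨x, rfl⟩ := hy
      obtain ⟨x', rfl⟩ := hy'
      rw [entry_extend]
      refine ha _ _ ?_
      by_contra! h
      exact absurd (hR x x' h) (not_le.2 (lt_of_le_of_lt (le_max_left _ _) hyy))
    · exact entry_extend_of_notMem_right _ _ _ _ hy'
  · exact entry_extend_of_notMem_left _ _ _ _ hy

theorem exists_embedding_of_injective_coarse {f : X → Y} (hf : Function.Injective f)
    (hc : IsCoarseMap f) :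
    ∃ Φ : uniformRoeAlgebra X →⋆ₙₐ[ℂ] uniformRoeAlgebra Y, Function.Injective Φ := by
  refine ⟨{ toFun := fun a => ⟨extendHom f hf a, extend_mem hf hc a.2⟩
            map_smul' := fun c a => Subtype.ext (map_smul (extendHom f hf) c (a : B X))
            map_zero' := Subtype.ext (map_zero (extendHom f hf))
            map_add' := fun a b => Subtype.ext (map_add (extendHom f hf) (a : B X) (b : B X))
            map_mul' := fun a b => Subtype.ext (map_mul (extendHom f hf) (a : B X) (b : B X))
            map_star' := fun a => Subtype.ext (map_star (extendHom f hf) (a : B X)) }, ?_⟩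
  intro a b hab
  have h := congrArg (compress f hf) (congrArg Subtype.val hab)
  refine Subtype.ext ?_
  have e : ∀ a : B X, compress f hf (extendHom f hf a) = a := compress_extend f hf
  exact (e a).symm.trans (h.trans (e b))

end Conjugation

/-! ### Functional calculus for almost idempotents -/

section AlmostProjection

variable {A : Type u} [CStarAlgebra A]

/-- A self-adjoint almost idempotent element `a` of a closed `*`-subalgebra `S` is close to a
projection in the ideal `a S`. -/
theorem exists_mul_isStarProjection {S : StarSubalgebra ℂ A} (hS : IsClosed (S : Set A)) {a : A}
    (ha : a ∈ S) (hsa : IsSelfAdjoint a) (hid : ‖a * a - a‖ ≤ 1 / 32) :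
    ∃ k ∈ S, IsStarProjection (a * k) ∧ ‖a * k - a‖ ≤ 1 / 16 := by
  -- `h` is `0` below `1/4` and `1` above `3/4`. The factorization `h t = t * k t` exhibits the
  -- projection as `a * k`, so that it stays in the right ideal of ghosts when `a` is a ghost.
  let h : ℝ → ℝ := fun t => max 0 (min 1 (2 * t - 1 / 2))
  let k : ℝ → ℝ := fun t => h t / max t (1 / 4)
  have hh : Continuous h := by fun_prop
  have hk : Continuous k := hh.div (by fun_prop) fun t => by positivity
  have hhk : ∀ t, h t = t * k t := by
    intro t
    rcases le_total t (1 / 4) with ht | ht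
    · have : h t = 0 := max_eq_left (min_le_of_right_le (by linarith))
      simp [k, this]
    · simp only [k, max_eq_left ht]
      field_simp
  have hspec : ∀ t ∈ spectrum ℝ a, |t * t - t| ≤ 1 / 32 := by
    intro t ht
    have h1 := norm_apply_le_norm_cfc (fun t : ℝ => t * t - t) a ht
    rw [cfc_sub (fun t : ℝ => t * t) (fun t => t) a, cfc_mul (fun t : ℝ => t) (fun t => t) a,
      cfc_id' ℝ a] at h1
    exact h1.trans hid
  -- One of `|t|`, `|1 - t|` is at least `1/2`, so the other is at most `2 * (1/32)`.
  have hcases : ∀ t ∈ spectrum ℝ a, (|t| ≤ 1 / 16 ∧ h t = 0) ∨ (|1 - t| ≤ 1 / 16 ∧ h t = 1) := by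
    intro t ht
    have h1 := abs_le.1 (hspec t ht)
    rcases le_total t (1 / 2) with h2 | h2
    · left
      have h3 : |t| ≤ 1 / 16 := abs_le.2 ⟨by nlinarith, by nlinarith⟩
      refine ⟨h3, max_eq_left (min_le_of_right_le ?_)⟩
      linarith [abs_le.1 h3]
    · right
      have h3 : |1 - t| ≤ 1 / 16 := abs_le.2 ⟨by nlinarith, by nlinarith⟩
      refine ⟨h3, ?_⟩
      have := abs_le.1 h3
      simp only [h]
      rw [min_eq_left (by linarith), max_eq_right zero_le_one]
  have hmem : ∀ f : ℝ → ℝ, cfc f a ∈ S := by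
    intro f
    rw [cfc_real_eq_complex f hsa]
    exact StarAlgebra.elemental.le_of_mem hS ha (cfc_mem_elemental _ a)
  clear_value k h
  have e : cfc h a = a * cfc k a := by
    have := cfc_mul (fun t : ℝ => t) k a
    rw [cfc_id' ℝ a] at this
    rw [← this]
    exact cfc_congr fun t _ => hhk t
  refine ⟨cfc k a, hmem k, ?_⟩
  rw [← e]
  refine ⟨⟨?_, cfc_predicate h a⟩, ?_⟩
  · rw [IsIdempotentElem, ← cfc_mul h h a]
    refine cfc_congr fun t ht => ?_
    rcases hcases t ht with ⟨_, h1⟩ | ⟨_, h1⟩ <;> simp [h1]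
  · have e : cfc h a - a = cfc (fun t => h t - t) a := by
      rw [cfc_sub h (fun t => t) a, cfc_id' ℝ a]
    rw [e]
    refine norm_cfc_le (by norm_num) fun t ht => ?_
    rcases hcases t ht with ⟨h0, h1⟩ | ⟨h0, h1⟩
    · rw [h1, zero_sub, norm_neg]; exact h0
    · rw [h1]; exact h0

end AlmostProjection

/-! ### Ghosts form a right ideal -/

section Ghost

variable {Z : Type u} [MetricSpace Z]

theorem UniformlyLocallyFinite.subtype (h : UniformlyLocallyFinite Z) (S : Set Z) :
    UniformlyLocallyFinite S := by
  intro r hr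
  obtain ⟨N, hN⟩ := h r hr
  refine ⟨N, fun x => le_trans ?_ (hN x)⟩
  rw [← Subtype.val_injective.encard_image]
  refine Set.encard_le_encard ?_
  rintro _ ⟨y, hy, rfl⟩
  exact hy

theorem IsGhost.mul_of_finitePropagation (hZ : UniformlyLocallyFinite Z) {a b : B Z}
    (ha : IsGhost a) (hb : FinitePropagation b) : IsGhost (a * b) := by
  classical
  obtain ⟨s, hs, hb⟩ := hb
  obtain ⟨N, hN⟩ := hZ s hs
  intro ε hε
  obtain ⟨A, hA, hAε⟩ := ha (ε / ((N + 1) * (‖b‖ + 1))) (by positivity)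
  -- Adding the `s`-balls ensures that every `z` within `s` of `x` avoids `A`; at most `N` such `z`
  -- contribute to the entry.
  refine ⟨A ∪ ⋃ z ∈ A, Metric.closedBall z s,
    hA.union (hA.biUnion fun z _ => hZ.finite_closedBall z s), fun x y hx hy => ?_⟩
  have hfin := hZ.finite_closedBall x s
  have hsupp : b (delta x) = ∑ z ∈ hfin.toFinset, entry b x z • delta z := by
    ext w
    simp only [lp.coeFn_sum, Finset.sum_apply, lp.coeFn_smul, Pi.smul_apply, delta_apply,
      smul_eq_mul, mul_ite, mul_one, mul_zero]
    rw [Finset.sum_ite_eq, ← entry_eq]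
    split_ifs with hw
    · rfl
    · refine hb _ _ ?_
      rw [Set.Finite.mem_toFinset, Metric.mem_closedBall, not_le] at hw
      rwa [dist_comm]
  have hcard : (hfin.toFinset.card : ℝ) ≤ N := by
    have := hN x
    rw [hfin.encard_eq_coe_toFinset_card] at this
    exact_mod_cast this
  have e : entry (a * b) x y = ∑ z ∈ hfin.toFinset, entry b x z * entry a z y := by
    rw [entry, mul_apply_eq_comp, hsupp, map_sum, inner_sum]
    refine Finset.sum_congr rfl fun z _ => ?_
    rw [map_smul, inner_smul_right]
    rfl
  rw [e]
  have hterm : ∀ z ∈ hfin.toFinset, ‖entry b x z * entry a z y‖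
      ≤ (‖b‖ + 1) * (ε / ((N + 1) * (‖b‖ + 1))) := by
    intro z hz
    rw [norm_mul]
    have hz' : z ∉ A := by
      intro hzA
      refine hx (Or.inr (Set.mem_biUnion hzA ?_))
      rw [Set.Finite.mem_toFinset, Metric.mem_closedBall] at hz
      rwa [Metric.mem_closedBall, dist_comm]
    have h1 := norm_entry_le b x z
    have h2 := (hAε z y hz' fun h => hy (Or.inl h)).le
    gcongr
    linarith
  calc _ ≤ hfin.toFinset.card • ((‖b‖ + 1) * (ε / ((N + 1) * (‖b‖ + 1)))) :=
        Finset.sum_le_card_nsmul _ _ _ hterm |> (norm_sum_le _ _).trans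
    _ = hfin.toFinset.card * (ε / (N + 1)) := by
        rw [nsmul_eq_mul]
        field_simp
    _ ≤ N * (ε / (N + 1)) := by gcongr
    _ < ε := by
        rw [mul_div_assoc', div_lt_iff₀ (by positivity)]
        nlinarith

theorem IsGhost.mul_mem (hZ : UniformlyLocallyFinite Z) {a b : B Z}
    (ha : IsGhost a) (hb : b ∈ uniformRoeAlgebra Z) : IsGhost (a * b) := by
  intro ε hε
  obtain ⟨b', hb', hbb⟩ := Metric.mem_closure_iff.1 hb (ε / 2 / (‖a‖ + 1)) (by positivity)
  obtain ⟨A, hA, h⟩ := ha.mul_of_finitePropagation hZ hb' (ε / 2) (by positivity)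
  refine ⟨A, hA, fun x y hx hy => ?_⟩
  have h1 := h x y hx hy
  have h2 := norm_entry_le (a * b - a * b') x y
  rw [entry_sub, ← mul_sub] at h2
  have h3 := norm_mul_le a (b - b')
  rw [dist_eq_norm, lt_div_iff₀ (by positivity)] at hbb
  have h4 := norm_add_le (entry (a * b) x y - entry (a * b') x y) (entry (a * b') x y)
  rw [sub_add_cancel] at h4
  nlinarith [norm_nonneg (b - b')]

/-- A self-adjoint almost idempotent ghost in the uniform Roe algebra is close to a ghost
projection. -/
theorem exists_ghost_projection (hZ : UniformlyLocallyFinite Z) {a : B Z}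
    (ha : a ∈ uniformRoeAlgebra Z) (hsa : IsSelfAdjoint a) (hg : IsGhost a)
    (hid : ‖a * a - a‖ ≤ 1 / 32) :
    ∃ p : B Z, p ∈ uniformRoeAlgebra Z ∧ IsStarProjection p ∧ IsGhost p ∧ ‖p - a‖ ≤ 1 / 16 := by
  obtain ⟨k, hk, hp, hn⟩ := exists_mul_isStarProjection (S := uniformRoeAlgebra Z)
    (algebraicUniformRoeAlgebra Z).isClosed_topologicalClosure ha hsa hid
  exact ⟨a * k, mul_mem ha hk, hp, hg.mul_mem hZ hk, hn⟩

end Ghost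

/-- Orthonormal vectors are `√2` apart and `K` moves each by at most `1/4`, so their images have no
Cauchy subsequence. -/
theorem not_isCompactOperator_of_orthonormal {H : Type u} [NormedAddCommGroup H]
    [InnerProductSpace ℂ H] {K : H →L[ℂ] H} {ξ : ℕ → H} (hξ : Orthonormal ℂ ξ)
    (h : ∀ n, ‖K (ξ n) - ξ n‖ ≤ 1 / 4) : ¬ IsCompactOperator K := by
  intro hK
  have hc := IsCompactOperator.isCompact_closure_image_closedBall (f := (K : H →ₗ[ℂ] H)) hK 1
  obtain ⟨x, -, φ, hφ, hx⟩ := hc.tendsto_subseq (x := fun n => K (ξ n)) fun n =>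
    subset_closure ⟨ξ n, by simp [hξ.1 n], rfl⟩
  obtain ⟨N, hN⟩ := Metric.cauchySeq_iff.1 hx.cauchySeq (1 / 2) (by norm_num)
  have h1 := hN N le_rfl (N + 1) (Nat.le_succ N)
  have h2 := h (φ N)
  have h3 := h (φ (N + 1))
  have hne : φ N ≠ φ (N + 1) := (hφ (Nat.lt_succ_self N)).ne
  have h4 : ‖ξ (φ N) - ξ (φ (N + 1))‖ ^ 2 = 2 := by
    rw [@norm_sub_sq ℂ, hξ.2 hne, hξ.1, hξ.1]
    norm_num
  simp only [Function.comp_apply, dist_eq_norm] at h1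
  have e : ξ (φ N) - ξ (φ (N + 1)) = (K (ξ (φ N)) - K (ξ (φ (N + 1)))) -
      (K (ξ (φ N)) - ξ (φ N)) + (K (ξ (φ (N + 1))) - ξ (φ (N + 1))) := by abel
  have h5 := norm_add_le ((K (ξ (φ N)) - K (ξ (φ (N + 1)))) - (K (ξ (φ N)) - ξ (φ N)))
    (K (ξ (φ (N + 1))) - ξ (φ (N + 1)))
  rw [← e] at h5
  have h6 := norm_sub_le (K (ξ (φ N)) - K (ξ (φ (N + 1)))) (K (ξ (φ N)) - ξ (φ N))
  nlinarith [norm_nonneg (ξ (φ N) - ξ (φ (N + 1)))]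

/-! ### Uniform lower bound on columns -/

section LowerBound

variable {X : Type u} {Y : Type v} [MetricSpace X] [MetricSpace Y]
  {ρ : uniformRoeAlgebra X →⋆ₙₐ[ℂ] B Y}

theorem sparse_iUnion_finset {F : ℕ → Finset Y}
    (hfar : ∀ m n, m < n → ∀ y ∈ F m, ∀ z ∈ F n, (n : ℝ) ≤ dist y z) :
    Sparse (⋃ n, (F n : Set Y) : Set Y) := by
  refine ⟨fun n => {z | (z : Y) ∈ F n}, fun n => ?_, ?_, ?_, fun R => ?_⟩
  · exact (F n).finite_toSet.preimage Subtype.val_injective.injOn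
  · have key : ∀ m n, m < n → ∀ y : Y, y ∈ F m → y ∈ F n → False := by
      intro m n hmn y h1 h2
      have h := hfar m n hmn y h1 y h2
      rw [dist_self] at h
      have : (0 : ℝ) < n := by exact_mod_cast (Nat.zero_le m).trans_lt hmn
      linarith
    intro m n hmn
    refine Set.disjoint_left.2 fun z h1 h2 => ?_
    rcases lt_or_gt_of_ne hmn with h | h
    · exact key _ _ h _ h1 h2
    · exact key _ _ h _ h2 h1
  · rw [Set.eq_univ_iff_forall]
    rintro ⟨z, hz⟩
    simpa using hz
  -- The larger index, which bounds the distance below, is at least half of `n + m`.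
  · obtain ⟨N, hN⟩ := exists_nat_ge (2 * R)
    refine ⟨N, fun n m hnm hN' x hx y hy => ?_⟩
    have hN2 : (N : ℝ) ≤ n + m := by exact_mod_cast hN'
    rcases lt_or_gt_of_ne hnm with h | h
    · have h1 := hfar n m h x hx y hy
      have h2 : (n : ℝ) < m := by exact_mod_cast h
      rw [Subtype.dist_eq]
      linarith
    · have h1 := hfar m n h y hy x hx
      have h2 : (m : ℝ) < n := by exact_mod_cast h
      rw [Subtype.dist_eq, dist_comm]
      linarith

/-- A ghost projection of infinite rank in the uniform Roe algebra is not almost supported on a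
subspace yielding only compact ghost projections. -/
theorem not_orthonormal_of_ghost (hY : UniformlyLocallyFinite Y) {Z : Set Y}
    (hZc : YieldsOnlyCompactGhostProjections Z) {q : B Y} (hqm : q ∈ uniformRoeAlgebra Y)
    (hqq : q * q = q) (hqs : star q = q) (hqle : ∀ v, ‖q v‖ ≤ ‖v‖) (hqghost : IsGhost q)
    (hqZ : ∀ v, ‖chi Zᶜ (q v)‖ ≤ 1 / 32 * ‖v‖) {ξ : ℕ → L2 Y} (hon : Orthonormal ℂ ξ)
    (hqξ : ∀ n, q (ξ n) = ξ n) : False := by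
  have hξ1 := hon.1
  set W : L2 Z →L[ℂ] L2 Y := pushCLM (Subtype.val : Z → Y) Subtype.val_injective with hW
  have hWn : ∀ v, ‖W v‖ = ‖v‖ := norm_pushCLM_apply _ _
  have hWW : ∀ v, W (W.adjoint v) = v - chi Zᶜ v := by
    intro v
    rw [chi_compl_apply, sub_sub_cancel]
    rfl
  set a : B Z := compress (Subtype.val : Z → Y) Subtype.val_injective q with ha
  have haa : ∀ v, a v = W.adjoint (q (W v)) := fun v => rfl
  have hasa : IsSelfAdjoint a := by
    rw [IsSelfAdjoint, ContinuousLinearMap.star_eq_adjoint, ha, compress,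
      ContinuousLinearMap.adjoint_comp, ContinuousLinearMap.adjoint_comp,
      ContinuousLinearMap.adjoint_adjoint, ← ContinuousLinearMap.star_eq_adjoint q, hqs,
      ContinuousLinearMap.comp_assoc]
  have haghost : IsGhost a := by
    intro ε hε
    obtain ⟨A, hA, h⟩ := hqghost ε hε
    refine ⟨Subtype.val ⁻¹' A, hA.preimage Subtype.val_injective.injOn, fun x y hx hy => ?_⟩
    rw [ha, entry_compress]
    exact h _ _ hx hy
  have haid : ‖a * a - a‖ ≤ 1 / 32 := by
    refine ContinuousLinearMap.opNorm_le_bound _ (by norm_num) fun v => ?_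
    -- Since `W W* = 1 - χ_{Zᶜ}`, idempotency of `q` leaves only a term containing `χ_{Zᶜ} q`, which
    -- is small.
    have e : (a * a - a) v = - W.adjoint (q (chi Zᶜ (q (W v)))) := by
      rw [_root_.sub_apply, mul_apply_eq_comp, haa, haa v, hWW, map_sub, map_sub,
        ← mul_apply_eq_comp q q, hqq]
      abel
    rw [e, norm_neg]
    calc _ ≤ _ := norm_adjoint_pushCLM_apply_le _ _ _
      _ ≤ _ := hqle _
      _ ≤ _ := hqZ _
      _ = _ := by rw [hWn]
  obtain ⟨p, hp, hpp, hpg, hpa⟩ :=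
    exists_ghost_projection (hY.subtype Z) (compress_mem hqm) hasa haghost haid
  have hpc := hZc p hp hpp hpg
  refine not_isCompactOperator_of_orthonormal (K := W ∘L p ∘L W.adjoint) hon (fun n => ?_)
    ((hpc.comp_clm W.adjoint).clm_comp W)
  have h1 : ‖(p - a) (W.adjoint (ξ n))‖ ≤ 1 / 16 := by
    refine (ContinuousLinearMap.le_of_opNorm_le _ hpa _).trans ?_
    have := norm_adjoint_pushCLM_apply_le (Subtype.val : Z → Y) Subtype.val_injective (ξ n)
    rw [hξ1] at this
    linarith
  have hZξ : ‖chi Zᶜ (ξ n)‖ ≤ 1 / 32 := by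
    have := hqZ (ξ n)
    rwa [hqξ, hξ1, mul_one] at this
  -- The errors add up to at most `1/16 + 3/32`, below the permitted `1/4`.
  have e : (W ∘L p ∘L W.adjoint) (ξ n) - ξ n = W ((p - a) (W.adjoint (ξ n)))
      - (q (chi Zᶜ (ξ n)) + chi Zᶜ (ξ n - q (chi Zᶜ (ξ n)))) := by
    simp only [ContinuousLinearMap.comp_apply, _root_.sub_apply, map_sub, haa, hWW, hqξ]
    abel
  rw [e]
  have h2 := norm_sub_le (W ((p - a) (W.adjoint (ξ n))))
    (q (chi Zᶜ (ξ n)) + chi Zᶜ (ξ n - q (chi Zᶜ (ξ n))))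
  have h3 := norm_add_le (q (chi Zᶜ (ξ n))) (chi Zᶜ (ξ n - q (chi Zᶜ (ξ n))))
  have h4 := hqle (chi Zᶜ (ξ n))
  have h5 := norm_sub_le (chi Zᶜ (ξ n)) (chi Zᶜ (q (chi Zᶜ (ξ n))))
  have h6 := norm_chi_apply_le Zᶜ (q (chi Zᶜ (ξ n)))
  rw [hWn] at h2
  rw [← map_sub] at h5
  linarith

/-- The image of a captured sequence of diagonal matrix units cannot be spread out over a sparse
subspace with matrix entries tending to zero. -/
theorem not_spread_of_captured (hY : UniformlyLocallyFinite Y)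
    (hghost : SparseSubspacesYieldOnlyCompactGhostProjections Y)
    (hρ : ∀ a, ρ a ∈ uniformRoeAlgebra Y) {g : ℕ → X} (hg : Function.Injective g)
    (hcap : Captured ρ (Set.range g)) (hne : ∀ n, ρ (roeUnit (g n) (g n)) ≠ 0)
    (hcomp : ∀ n, IsCompactOperator (ρ (roeUnit (g n) (g n)))) {F : ℕ → Finset Y}
    (hF : ∀ n v, ‖chi (F n : Set Y)ᶜ (ρ (roeUnit (g n) (g n)) v)‖
      ≤ 1 / 64 * (1 / 2) ^ n * ‖v‖)
    (hsmall : ∀ n y, ‖ρ (roeUnit (g n) (g n)) (delta y)‖ ≤ (1 / 2) ^ n)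
    (hfar : ∀ m n, m < n → ∀ y ∈ F m, ∀ z ∈ F n, (n : ℝ) ≤ dist y z) : False := by
  set Z : Set Y := ⋃ n, (F n : Set Y) with hZ
  set q : B Y := ρ (roeChi (Set.range g)) with hq
  have hqsum : ∀ v, HasSum (fun n => ρ (roeUnit (g n) (g n)) v) (q v) := hcap.hasSum hg
  have hqq : q * q = q := by rw [hq, ← map_mul, roeChi_mul_roeChi, Set.inter_self]
  have hqs : star q = q := by rw [hq, ← map_star, star_roeChi]
  have hqle : ∀ v, ‖q v‖ ≤ ‖v‖ := norm_map_roeChi_le ρ _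
  have hqZ : ∀ v, ‖chi Zᶜ (q v)‖ ≤ 1 / 32 * ‖v‖ := by
    intro v
    refine ((hqsum v).mapL (chi Zᶜ)).norm_le_of_bounded
      (g := fun n => 1 / 64 * (1 / 2) ^ n * ‖v‖) ?_ fun n => ?_
    · rw [show (1 / 32 : ℝ) * ‖v‖ = 1 / 64 * 2 * ‖v‖ by ring]
      exact (hasSum_geometric_two.mul_left (1 / 64 : ℝ)).mul_right ‖v‖
    · refine (norm_chi_apply_mono ?_ _).trans (hF n v)
      exact Set.compl_subset_compl.2 (Set.subset_iUnion (fun n => (F n : Set Y)) n)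
  have hqghost : IsGhost q := by
    -- Each summand tends to `0` in `y` by compactness and is dominated by `2⁻ⁿ`; hence the columns
    -- of `q` tend to `0`.
    have hlim : Tendsto (fun y => ∑' n, ‖ρ (roeUnit (g n) (g n)) (delta y)‖) cofinite
        (𝓝 (∑' _ : ℕ, (0 : ℝ))) := by
      refine tendsto_tsum_of_dominated_convergence (bound := fun n => (1 / 2 : ℝ) ^ n)
        summable_geometric_two (fun n => tendsto_norm_map_roeUnit_delta (hcomp n)) ?_
      refine Eventually.of_forall fun y n => ?_
      rw [norm_norm]
      exact hsmall n y
    rw [tsum_zero] at hlim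
    intro ε hε
    refine ⟨{y | ¬ ∑' n, ‖ρ (roeUnit (g n) (g n)) (delta y)‖ < ε},
      hlim.eventually (gt_mem_nhds hε), fun x y hx _ => ?_⟩
    rw [entry_eq]
    refine lt_of_le_of_lt ?_ (not_not.1 hx)
    have hs : Summable fun n => ‖ρ (roeUnit (g n) (g n)) (delta x)‖ :=
      Summable.of_nonneg_of_le (fun _ => norm_nonneg _) (fun n => hsmall n x)
        summable_geometric_two
    exact (norm_coord_le _ y).trans
      ((hqsum (delta x)).norm_le_of_bounded hs.hasSum fun _ => le_rfl)
  have hunit : ∀ n, ∃ ξ : L2 Y, ‖ξ‖ = 1 ∧ ρ (roeUnit (g n) (g n)) ξ = ξ := by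
    intro n
    obtain ⟨v, hv⟩ : ∃ v, ρ (roeUnit (g n) (g n)) v ≠ 0 := by
      by_contra! h
      exact hne n (ContinuousLinearMap.ext h)
    refine ⟨((‖ρ (roeUnit (g n) (g n)) v‖⁻¹ : ℝ) : ℂ) • ρ (roeUnit (g n) (g n)) v, ?_, ?_⟩
    · rw [norm_smul, Complex.norm_real, norm_inv, norm_norm,
        inv_mul_cancel₀ (norm_ne_zero_iff.2 hv)]
    · rw [map_smul, ← mul_apply_eq_comp, ← map_mul, roeUnit_mul_roeUnit]
  choose ξ hξ1 hξ using hunit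
  have hon : Orthonormal ℂ ξ := by
    refine ⟨hξ1, fun m n hmn => ?_⟩
    simp only
    rw [← hξ m, ← hξ n, inner_map_map, star_roeUnit, roeUnit_self, roeUnit_self,
      roeChi_mul_roeChi, Set.singleton_inter_eq_empty.2, roeChi_empty, map_zero,
      _root_.zero_apply, inner_zero_right]
    simpa using fun h => hmn (hg h)
  have hqξ : ∀ n, q (ξ n) = ξ n := by
    intro n
    rw [← hξ n, hq, ← mul_apply_eq_comp, ← map_mul, roeUnit_self, roeChi_mul_roeChi,
      Set.inter_eq_right.2 (by simp)]
  exact not_orthonormal_of_ghost hY (hghost Z (sparse_iUnion_finset hfar)) (hρ _) hqq hqs hqle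
    hqghost hqZ hon hqξ

/-- The images of the diagonal matrix units have uniformly large columns. -/
theorem exists_uniform_lower_bound (hY : UniformlyLocallyFinite Y)
    (hghost : SparseSubspacesYieldOnlyCompactGhostProjections Y)
    (hρ : ∀ a, ρ a ∈ uniformRoeAlgebra Y) (hne : ∀ x, ρ (roeUnit x x) ≠ 0)
    (hcomp : ∀ x, IsCompactOperator (ρ (roeUnit x x))) :
    ∃ δ : ℝ, 0 < δ ∧ ∀ x, ∃ y, δ ≤ ‖ρ (roeUnit x x) (delta y)‖ := by
  classical
  have := hY.countable
  by_contra! hcon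
  -- If only finitely many `x` had all columns at most `2⁻ʲ`, one `δ` would serve for every `x`.
  have hinf : ∀ j : ℕ, {x | ∀ y, ‖ρ (roeUnit x x) (delta y)‖ ≤ (1 / 2) ^ j}.Infinite := by
    intro j hfin
    have hpos : ∀ x, ∃ y, 0 < ‖ρ (roeUnit x x) (delta y)‖ := by
      intro x
      by_contra! h
      refine hne x (ext_delta fun y => ?_)
      rw [_root_.zero_apply]
      exact norm_le_zero_iff.1 (h y)
    choose η hη using hpos
    have hev : ∀ᶠ δ : ℝ in 𝓝[>] 0, 0 < δ ∧ δ < (1 / 2) ^ j ∧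
        ∀ x ∈ {x | ∀ y, ‖ρ (roeUnit x x) (delta y)‖ ≤ (1 / 2) ^ j},
          δ < ‖ρ (roeUnit x x) (delta (η x))‖ := by
      refine eventually_mem_nhdsWithin.and ?_
      refine Eventually.and (nhdsWithin_le_nhds (gt_mem_nhds (by positivity))) ?_
      rw [eventually_all_finite hfin]
      exact fun x _ => nhdsWithin_le_nhds (gt_mem_nhds (hη x))
    obtain ⟨δ, hδ, hδj, hδη⟩ := hev.exists
    obtain ⟨x, hx⟩ := hcon δ hδ
    exact absurd (hx (η x)) (not_lt.2 (hδη x fun y => ((hx y).trans hδj).le).le)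
  -- Recursive choice of triples: a point, its index `j`, and a finite set almost supporting its
  -- projection.
  obtain ⟨s, hsP, hsr⟩ := exists_seq_of_forall_finset_exists
    (fun t : X × ℕ × Finset Y => (∀ y, ‖ρ (roeUnit t.1 t.1) (delta y)‖ ≤ (1 / 2) ^ t.2.1) ∧
      ∀ v, ‖chi (t.2.2 : Set Y)ᶜ (ρ (roeUnit t.1 t.1) v)‖ ≤ 1 / 64 * (1 / 2) ^ t.2.1 * ‖v‖)
    (fun t t' => t.1 ≠ t'.1 ∧ t.2.1 < t'.2.1 ∧
      ∀ y ∈ t.2.2, ∀ z ∈ t'.2.2, (t'.2.1 : ℝ) ≤ dist y z) (by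
    intro s _
    set j := s.sup (fun t => t.2.1) + 1 with hj
    have hHfin : (⋃ t ∈ s, ⋃ y ∈ t.2.2, Metric.closedBall y (j : ℝ)).Finite :=
      s.finite_toSet.biUnion fun t _ => t.2.2.finite_toSet.biUnion fun y _ =>
        hY.finite_closedBall y j
    set H := hHfin.toFinset with hH
    have hsum : Tendsto (fun x => ∑ y ∈ H, ‖ρ (roeUnit x x) (delta y)‖) cofinite (𝓝 0) := by
      simpa using tendsto_finsetSum H fun y _ => tendsto_norm_map_roeUnit ρ (delta y)
    have hev : ∀ᶠ x in cofinite, ∑ y ∈ H, ‖ρ (roeUnit x x) (delta y)‖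
        < 1 / 128 * (1 / 2) ^ j := hsum.eventually (gt_mem_nhds (by positivity))
    have hev2 : ∀ᶠ x in cofinite, x ∉ s.image Prod.fst :=
      (s.image Prod.fst).eventually_cofinite_notMem
    obtain ⟨x, hx, hx1, hx2⟩ := ((frequently_cofinite_iff_infinite.2 (hinf j)).and_eventually
      (hev.and hev2)).exists
    obtain ⟨F, hF⟩ := exists_finset_norm_chi_compl_le (hcomp x)
      (show (0 : ℝ) < 1 / 128 * (1 / 2) ^ j by positivity)
    -- `H` is the `j`-neighbourhood of the earlier sets. Removing it makes the new set far from
    -- them, at a cost controlled by the small columns over `H`.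
    refine ⟨(x, j, F \ H), ⟨hx, fun v => ?_⟩, fun t ht => ⟨?_, ?_, ?_⟩⟩
    · have e : ((F \ H : Finset Y) : Set Y)ᶜ = (F : Set Y)ᶜ ∪ (H : Set Y) := by
        rw [Finset.coe_sdiff, Set.compl_sdiff, Set.union_comm]
      simp only
      rw [e]
      have h1 := norm_chi_union_apply_le (F : Set Y)ᶜ (H : Set Y) (ρ (roeUnit x x) v)
      have h2 := norm_chi_finset_map_roeUnit_le (ρ := ρ) H x v
      have h3 := hF v
      have h4 := mul_le_mul_of_nonneg_right hx1.le (norm_nonneg v)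
      linarith
    · rintro rfl
      exact hx2 (Finset.mem_image_of_mem _ ht)
    · exact Nat.lt_succ_of_le (Finset.le_sup (f := fun t : X × ℕ × Finset Y => t.2.1) ht)
    · intro y hy z hz
      by_contra! h
      refine (Finset.mem_sdiff.1 hz).2 ?_
      rw [hH, Set.Finite.mem_toFinset]
      refine Set.mem_biUnion ht (Set.mem_biUnion hy ?_)
      rw [Metric.mem_closedBall, dist_comm]
      exact h.le)
  have hmono : StrictMono fun n => (s n).2.1 := fun m n h => (hsr m n h).2.1
  have hg : Function.Injective fun n => (s n).1 := by
    intro m n h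
    by_contra hmn
    rcases lt_or_gt_of_ne hmn with h' | h'
    · exact (hsr _ _ h').1 h
    · exact (hsr _ _ h').1 h.symm
  obtain ⟨φ, hφ, hcap⟩ := exists_captured_subseq ρ hg
  have hle : ∀ n, n ≤ (s (φ n)).2.1 := fun n => (hφ.le_apply).trans hmono.le_apply
  have hpow : ∀ n, (1 / 2 : ℝ) ^ (s (φ n)).2.1 ≤ (1 / 2) ^ n := fun n =>
    pow_le_pow_of_le_one (by norm_num) (by norm_num) (hle n)
  refine not_spread_of_captured hY hghost hρ (hg.comp hφ.injective) hcap (fun n => hne _)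
    (fun n => hcomp _) (F := fun n => (s (φ n)).2.2) (fun n v => ?_) (fun n y => ?_) ?_
  · refine ((hsP (φ n)).2 v).trans ?_
    exact mul_le_mul_of_nonneg_right (mul_le_mul_of_nonneg_left (hpow n) (by norm_num))
      (norm_nonneg v)
  · exact ((hsP (φ n)).1 y).trans (hpow n)
  · intro m n hmn y hy z hz
    refine le_trans ?_ ((hsr _ _ (hφ hmn)).2.2 y hy z hz)
    exact_mod_cast hle n

end LowerBound

/-! ### Fibre colourings and entry estimates -/

section Entries

variable {X : Type u} {Y : Type v}

theorem exists_coloring_of_encard_fiber_le {f : X → Y} {N : ℕ}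
    (h : ∀ y, (f ⁻¹' {y}).encard ≤ N) :
    ∃ κ : X → Fin (N + 1), ∀ x x', κ x = κ x' → f x = f x' → x = x' := by
  have hex : ∀ y, ∃ e : X → Fin (N + 1), Set.InjOn e (f ⁻¹' {y}) := by
    intro y
    have hfin := Set.finite_of_encard_le_coe (h y)
    have hc : (f ⁻¹' {y}).encard ≤ (Set.univ : Set (Fin (N + 1))).encard := by
      rw [Set.encard_univ, ENat.card_eq_coe_fintype_card, Fintype.card_fin]
      exact (h y).trans (by exact_mod_cast Nat.le_succ N)
    obtain ⟨e, -, he⟩ := hfin.exists_injOn_of_encard_le hc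
    exact ⟨e, he⟩
  choose e he using hex
  refine ⟨fun x => e (f x) x, fun x x' hk hf => ?_⟩
  refine he (f x) rfl hf.symm ?_
  simpa only [hf] using hk

variable [MetricSpace X] {ρ : uniformRoeAlgebra X →⋆ₙₐ[ℂ] B Y}

/-- The entry is the inner product of `ρ(e_xx) δ_y` with the vector `ρ(e_xx') δ_y'` of norm at most
`1`. -/
theorem norm_entry_map_roeUnit_le (x x' : X) (y y' : Y) :
    ‖entry (ρ (roeUnit x x')) y' y‖ ≤ ‖ρ (roeUnit x x) (delta y)‖ := by
  have h := inner_map_map ρ (roeUnit x x) (roeUnit x x') (delta y) (delta y')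
  rw [star_roeUnit, roeUnit_mul_roeUnit] at h
  rw [entry, ← h]
  refine (norm_inner_le_norm _ _).trans ?_
  have h2 := norm_map_roeUnit ρ x' x (delta y')
  have h3 := norm_map_roeUnit_self_le ρ x' (delta y')
  rw [norm_delta] at h3
  rw [h2]
  exact mul_le_of_le_one_right (norm_nonneg _) h3

end Entries

/-! ### Coarseness from large entries -/

section Coarse

variable {X : Type u} {Y : Type v} [MetricSpace X] [MetricSpace Y]
  {ρ : uniformRoeAlgebra X →⋆ₙₐ[ℂ] B Y}

/-- A map along which the images of the matrix units have uniformly large entries is coarse. -/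
theorem isCoarseMap_of_le_entry (hX : UniformlyLocallyFinite X) [Countable Y]
    (hρ : ∀ a, ρ a ∈ uniformRoeAlgebra Y) (hcomp : ∀ x, IsCompactOperator (ρ (roeUnit x x)))
    {f : X → Y} (hf : Tendsto f cofinite cofinite) {P : Set X} {c : ℝ} (hc : 0 < c)
    (hP : ∀ x ∈ P, ∀ x' ∈ P, c ≤ ‖entry (ρ (roeUnit x x')) (f x') (f x)‖) :
    IsCoarseMap fun x : P => f x := by
  classical
  intro r hr
  by_contra! hcon
  -- Close pairs meeting a finite set have bounded image distance, so pairs with far images avoid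
  -- any prescribed finite set.
  have hball : ∀ E : Set X, E.Finite →
      ∃ R : ℝ, ∀ x ∈ E, ∀ x', dist x x' ≤ r → dist (f x) (f x') ≤ R := by
    intro E hE
    have hfin : (⋃ x ∈ E, (fun x' => dist (f x) (f x')) '' Metric.closedBall x r).Finite :=
      hE.biUnion fun x _ => (hX.finite_closedBall x r).image _
    obtain ⟨R, hR⟩ := hfin.bddAbove
    refine ⟨R, fun x hx x' hxx => hR (Set.mem_biUnion hx ⟨x', ?_, rfl⟩)⟩
    rwa [Metric.mem_closedBall, dist_comm]
  -- Triples `(x, x', j)` with images more than `j` apart, chosen so that the projection at one `x`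
  -- has tiny columns at the images of the others.
  obtain ⟨s, hsP, hsr⟩ := exists_seq_of_forall_finset_exists
    (fun t : X × X × ℕ => t.1 ∈ P ∧ t.2.1 ∈ P ∧ dist t.1 t.2.1 ≤ r ∧
      (t.2.2 : ℝ) < dist (f t.1) (f t.2.1))
    (fun t t' => t.2.2 < t'.2.2 ∧ t.1 ≠ t'.1 ∧ t.2.1 ≠ t'.2.1 ∧
      ‖ρ (roeUnit t.1 t.1) (delta (f t'.1))‖ ≤ c / 8 * (1 / 2) ^ t'.2.2 ∧
      ‖ρ (roeUnit t'.1 t'.1) (delta (f t.1))‖ ≤ c / 8 * (1 / 2) ^ t'.2.2) (by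
    intro s _
    set j := s.sup (fun t => t.2.2) + 1 with hj
    have hη : (0 : ℝ) < c / 8 * (1 / 2) ^ j := by positivity
    have hev : ∀ᶠ w in cofinite, ∀ t ∈ s, t.1 ≠ w ∧
        ‖ρ (roeUnit t.1 t.1) (delta (f w))‖ ≤ c / 8 * (1 / 2) ^ j ∧
        ‖ρ (roeUnit w w) (delta (f t.1))‖ ≤ c / 8 * (1 / 2) ^ j := by
      rw [eventually_all_finset]
      intro t _
      refine Eventually.and ?_ (Eventually.and ?_ ?_)
      · exact (eventually_cofinite_ne t.1).mono fun _ h => h.symm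
      · exact (((tendsto_norm_map_roeUnit_delta (hcomp t.1)).comp hf).eventually
          (gt_mem_nhds hη)).mono fun _ h => h.le
      · exact ((tendsto_norm_map_roeUnit ρ (delta (f t.1))).eventually
          (gt_mem_nhds hη)).mono fun _ h => h.le
    obtain ⟨R, hR⟩ := hball _ hev
    obtain ⟨R', hR'⟩ := hball _ (s.image fun t => t.2.1).finite_toSet
    obtain ⟨⟨x, hx⟩, ⟨x', hx'⟩, hxx, hfar⟩ := hcon (max (max R R') j)
    change dist x x' ≤ r at hxx
    change _ < dist (f x) (f x') at hfar
    have hQ : ∀ t ∈ s, t.1 ≠ x ∧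
        ‖ρ (roeUnit t.1 t.1) (delta (f x))‖ ≤ c / 8 * (1 / 2) ^ j ∧
        ‖ρ (roeUnit x x) (delta (f t.1))‖ ≤ c / 8 * (1 / 2) ^ j := by
      by_contra h
      have := hR x h x' hxx
      exact absurd hfar (not_lt.2 (this.trans ((le_max_left _ _).trans (le_max_left _ _))))
    have hQ' : x' ∉ s.image fun t => t.2.1 := by
      intro h
      have := hR' x' h x (by rwa [dist_comm])
      rw [dist_comm] at this
      exact absurd hfar (not_lt.2 (this.trans ((le_max_right _ _).trans (le_max_left _ _))))
    refine ⟨(x, x', j), ⟨hx, hx', hxx, (le_max_right _ _).trans_lt hfar⟩, fun t ht => ?_⟩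
    obtain ⟨h1, h2, h3⟩ := hQ t ht
    refine ⟨?_, h1, ?_, h2, h3⟩
    · exact Nat.lt_succ_of_le (Finset.le_sup (f := fun t : X × X × ℕ => t.2.2) ht)
    · rintro rfl
      exact hQ' (Finset.mem_image_of_mem (fun t : X × X × ℕ => t.2.1) ht))
  have hmono : StrictMono fun n => (s n).2.2 := fun m n h => (hsr m n h).1
  have hinj : ∀ {α : Type u} (F : ℕ → α), (∀ m n, m < n → F m ≠ F n) → Function.Injective F := by
    intro α F h m n hmn
    by_contra hne
    rcases lt_or_gt_of_ne hne with h' | h'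
    · exact h _ _ h' hmn
    · exact h _ _ h' hmn.symm
  have hg := hinj (fun n => (s n).1) fun m n h => (hsr m n h).2.1
  have hg' := hinj (fun n => (s n).2.1) fun m n h => (hsr m n h).2.2.1
  obtain ⟨φ, hφ, hcap⟩ := exists_captured_subseq ρ hg
  set x : ℕ → X := (fun n => (s n).1) ∘ φ with hx
  set x' : ℕ → X := (fun n => (s n).2.1) ∘ φ with hx'
  have hxi : Function.Injective x := hg.comp hφ.injective
  have hxi' : Function.Injective x' := hg'.comp hφ.injective
  have hle : ∀ n, n ≤ (s (φ n)).2.2 := fun n => (hφ.le_apply).trans hmono.le_apply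
  have hoff : ∀ k n, k ≠ n →
      ‖ρ (roeUnit (x k) (x k)) (delta (f (x n)))‖ ≤ c / 8 * (1 / 2) ^ k := by
    intro k n hkn
    rcases lt_or_gt_of_ne hkn with h | h
    · refine (hsr _ _ (hφ h)).2.2.2.1.trans ?_
      gcongr ?_ * ?_
      exact pow_le_pow_of_le_one (by norm_num) (by norm_num) (h.le.trans (hle n))
    · refine (hsr _ _ (hφ h)).2.2.2.2.trans ?_
      gcongr ?_ * ?_
      exact pow_le_pow_of_le_one (by norm_num) (by norm_num) (hle k)
  let a : uniformRoeAlgebra X := ⟨transl x x' hxi hxi',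
    (propagationLE_transl x x' hxi hxi' fun n => (hsP (φ n)).2.2.1).mem_uniformRoeAlgebra⟩
  have ha1 : roeChi (Set.range x) * a = a := Subtype.ext (chi_range_mul_transl x x' hxi hxi')
  have ha2 : ∀ n, roeUnit (x n) (x n) * a = roeUnit (x n) (x' n) := fun n =>
    Subtype.ext (matrixUnit_mul_transl x x' hxi hxi' n)
  -- Only the range of `x` must be captured: the sum for `ρ(χ)` is applied to `ρ(a) v`, and `e_{x_n
  -- x_n} a = e_{x_n x'_n}`.
  have hsum : ∀ v, HasSum (fun n => ρ (roeUnit (x n) (x' n)) v) (ρ a v) := by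
    intro v
    have h := hcap.hasSum hxi (ρ a v)
    rw [← mul_apply_eq_comp, ← map_mul, ha1] at h
    simpa only [← mul_apply_eq_comp, ← map_mul, ha2] using h
  obtain ⟨b, ⟨t, _, hb⟩, hab⟩ := Metric.mem_closure_iff.1 (hρ a) (c / 2) (by positivity)
  rw [dist_eq_norm] at hab
  obtain ⟨n, hn⟩ := exists_nat_ge t
  have hentry : HasSum (fun k => entry (ρ (roeUnit (x k) (x' k))) (f (x' n)) (f (x n)))
      (entry (ρ a) (f (x' n)) (f (x n))) :=
    (hsum (delta (f (x' n)))).mapL (innerSL ℂ (delta (f (x n))))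
  have hdiff := hentry.sub (hasSum_ite_eq n
    (entry (ρ (roeUnit (x n) (x' n))) (f (x' n)) (f (x n))))
  -- The other terms contribute at most `c/4` to an entry whose main term is at least `c`, while
  -- approximation by `b` makes the whole entry less than `c/2`.
  have h1 : ‖entry (ρ a) (f (x' n)) (f (x n))
      - entry (ρ (roeUnit (x n) (x' n))) (f (x' n)) (f (x n))‖ ≤ c / 8 * 2 := by
    refine hdiff.norm_le_of_bounded (hasSum_geometric_two.mul_left (c / 8)) fun k => ?_
    split_ifs with hk
    · subst hk
      rw [sub_self, norm_zero]
      positivity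
    · rw [sub_zero]
      exact (norm_entry_map_roeUnit_le _ _ _ _).trans (hoff k n hk)
  have h2 := hP (x n) (hsP (φ n)).1 (x' n) (hsP (φ n)).2.1
  have h3 : entry b (f (x' n)) (f (x n)) = 0 := by
    refine hb _ _ ?_
    rw [dist_comm]
    refine lt_of_le_of_lt ?_ (hsP (φ n)).2.2.2
    exact hn.trans (by exact_mod_cast hle n)
  have h4 := (norm_entry_le (ρ a - b) (f (x' n)) (f (x n))).trans_lt hab
  rw [entry_sub, h3, sub_zero] at h4
  have h5 := norm_sub_norm_le (entry (ρ (roeUnit (x n) (x' n))) (f (x' n)) (f (x n)))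
    (entry (ρ a) (f (x' n)) (f (x n)))
  rw [norm_sub_rev] at h5
  linarith

end Coarse

/-! ### The finite partition; part (ii) -/

section Partition

variable {X : Type u} {Y : Type v} [MetricSpace X]
  {ρ : uniformRoeAlgebra X →⋆ₙₐ[ℂ] B Y}

/-- Bessel: the squared norms `‖ρ(e_xx) δ_y‖²` sum to at most `1` over `x`, and each point of the
fibre contributes at least `δ²`. -/
theorem encard_fiber_le {f : X → Y} {δ : ℝ} (hδ : 0 < δ) {N : ℕ} (hN : 1 / δ ^ 2 ≤ N)
    (hf : ∀ x, δ ≤ ‖ρ (roeUnit x x) (delta (f x))‖) (y : Y) : (f ⁻¹' {y}).encard ≤ N := by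
  by_contra! h
  obtain ⟨S, hS, hcard⟩ := Set.exists_subset_encard_eq (Order.add_one_le_of_lt h)
  have hfin : S.Finite := Set.finite_of_encard_eq_coe (k := N + 1) (by rw [hcard]; rfl)
  have h1 := sum_norm_sq_map_roeUnit_le ρ hfin.toFinset (delta y)
  have h2 : hfin.toFinset.card • δ ^ 2 ≤ ∑ x ∈ hfin.toFinset, ‖ρ (roeUnit x x) (delta y)‖ ^ 2 := by
    refine Finset.card_nsmul_le_sum _ _ _ fun x hx => ?_
    have hxy : f x = y := hS (hfin.mem_toFinset.1 hx)
    have := hf x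
    rw [hxy] at this
    gcongr
  have h3 : hfin.toFinset.card = N + 1 := by
    rw [hfin.encard_eq_coe_toFinset_card] at hcard
    exact_mod_cast hcard
  rw [norm_delta, one_pow] at h1
  rw [h3, nsmul_eq_mul] at h2
  rw [div_le_iff₀ (by positivity)] at hN
  push_cast at h2
  nlinarith [sq_pos_of_pos hδ]

/-- After a finite colouring, the images of matrix units have large entries along `f`. -/
theorem exists_coloring_le_entry {f : X → Y} {δ : ℝ} (hδ : 0 < δ)
    (hcomp : ∀ x, IsCompactOperator (ρ (roeUnit x x)))
    (hf : ∀ x, δ ≤ ‖ρ (roeUnit x x) (delta (f x))‖) (x₀ : X) :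
    ∃ (t : Set (L2 Y)) (_ : t.Finite) (κ : X → t), ∀ x x', κ x = κ x' →
      δ ^ 2 / 2 ≤ ‖entry (ρ (roeUnit x x')) (f x') (f x)‖ := by
  have htb : TotallyBounded (ρ (roeUnit x₀ x₀) '' Metric.closedBall 0 1) :=
    (IsCompactOperator.isCompact_closure_image_closedBall
      (f := (ρ (roeUnit x₀ x₀) : L2 Y →ₗ[ℂ] L2 Y)) (hcomp x₀) 1).totallyBounded.subset
      subset_closure
  obtain ⟨t, ht, hcov⟩ := Metric.totallyBounded_iff.1 htb (δ / 2) (by positivity)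
  -- The units `e_{x₀x}` carry all columns into the image of the unit ball under one compact
  -- operator; `κ` records a nearby point of a finite net.
  let v : X → L2 Y := fun x => ρ (roeUnit x₀ x) (delta (f x))
  have hvn : ∀ x, ‖v x‖ = ‖ρ (roeUnit x x) (delta (f x))‖ := fun x => norm_map_roeUnit ρ _ _ _
  have hex : ∀ x, ∃ c : t, dist (v x) c < δ / 2 := by
    intro x
    have hm : v x ∈ ρ (roeUnit x₀ x₀) '' Metric.closedBall 0 1 := by
      refine ⟨v x, ?_, ?_⟩
      · rw [mem_closedBall_zero_iff, hvn]
        simpa [norm_delta] using norm_map_roeUnit_self_le ρ x (delta (f x))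
      · simp only [v]
        rw [← mul_apply_eq_comp, ← map_mul, roeUnit_mul_roeUnit]
    have := hcov hm
    simp only [Set.mem_iUnion, Metric.mem_ball, exists_prop] at this
    obtain ⟨c, hc, h⟩ := this
    exact ⟨⟨c, hc⟩, h⟩
  choose κ hκ using hex
  refine ⟨t, ht, κ, fun x x' hxx => ?_⟩
  have hd : ‖v x - v x'‖ ≤ δ := by
    rw [← dist_eq_norm]
    have h1 := hκ x
    have h2 := hκ x'
    rw [← hxx, dist_comm] at h2
    linarith [dist_triangle (v x) (κ x) (v x')]
  have he : entry (ρ (roeUnit x x')) (f x') (f x) = ⟪v x, v x'⟫_ℂ := by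
    rw [inner_map_map, star_roeUnit, roeUnit_mul_roeUnit, entry]
  rw [he]
  refine le_trans ?_ (RCLike.re_le_norm _)
  -- Polarization: `2 Re ⟨v x, v x'⟩ ≥ δ² + δ² - δ²`.
  have h3 := @norm_sub_sq ℂ _ _ _ _ (v x) (v x')
  have h4 := hf x
  have h5 := hf x'
  rw [← hvn] at h4 h5
  have h6 : ‖v x - v x'‖ ^ 2 ≤ δ ^ 2 := by gcongr
  have h7 : δ ^ 2 ≤ ‖v x‖ ^ 2 := by gcongr
  have h8 : δ ^ 2 ≤ ‖v x'‖ ^ 2 := by gcongr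
  linarith

end Partition

/-- The pieces are the classes of a product colouring: `κ` separates points in the fibres of `f`,
and `τ` makes the entries along `f` large. -/
theorem exists_partition_of_compactPreserving {X : Type u} {Y : Type v} [MetricSpace X]
    [MetricSpace Y] (hX : UniformlyLocallyFinite X) (hY : UniformlyLocallyFinite Y)
    (hghost : SparseSubspacesYieldOnlyCompactGhostProjections Y)
    {Φ : uniformRoeAlgebra X →⋆ₙₐ[ℂ] uniformRoeAlgebra Y} (hΦ : Function.Injective Φ)
    (hc : CompactPreserving Φ) :
    ∃ (k : ℕ) (P : Fin k → Set X), 1 ≤ k ∧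
      Pairwise (fun i j => Disjoint (P i) (P j)) ∧ (⋃ i, P i) = Set.univ ∧
      ∀ i, ∃ f : P i → Y, Function.Injective f ∧ IsCoarseMap f := by
  rcases isEmpty_or_nonempty X with hX0 | ⟨⟨x₀⟩⟩
  · exact ⟨1, fun _ => Set.univ, le_rfl, fun i j h => absurd (Subsingleton.elim i j) h,
      Set.iUnion_const _, fun _ => ⟨fun x => isEmptyElim (x : X), fun x => isEmptyElim (x : X),
      fun _ _ => ⟨0, fun x => isEmptyElim (x : X)⟩⟩⟩
  have := hY.countable
  let ρ : uniformRoeAlgebra X →⋆ₙₐ[ℂ] B Y :=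
    { toFun := fun a => (Φ a : B Y)
      map_smul' := fun c a => congrArg Subtype.val (map_smul Φ c a)
      map_zero' := congrArg Subtype.val (map_zero Φ)
      map_add' := fun a b => congrArg Subtype.val (map_add Φ a b)
      map_mul' := fun a b => congrArg Subtype.val (map_mul Φ a b)
      map_star' := fun a => congrArg Subtype.val (map_star Φ a) }
  have hρ : ∀ a, ρ a ∈ uniformRoeAlgebra Y := fun a => (Φ a).2
  have hne : ∀ x, ρ (roeUnit x x) ≠ 0 := fun x h =>
    roeUnit_ne_zero x x (hΦ (Subtype.ext (h.trans (congrArg Subtype.val (map_zero Φ)).symm)))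
  have hcomp : ∀ x, IsCompactOperator (ρ (roeUnit x x)) := fun x =>
    hc _ (isCompactOperator_matrixUnit x x)
  obtain ⟨δ, hδ, hf⟩ := exists_uniform_lower_bound hY hghost hρ hne hcomp
  choose f hf using hf
  obtain ⟨N, hN⟩ := exists_nat_ge (1 / δ ^ 2)
  have hfib := encard_fiber_le hδ hN hf
  obtain ⟨κ, hκ⟩ := exists_coloring_of_encard_fiber_le hfib
  obtain ⟨t, ht, τ, hτ⟩ := exists_coloring_le_entry hδ hcomp hf x₀
  have hft : Tendsto f cofinite cofinite :=
    Tendsto.cofinite_of_finite_preimage_singleton fun y => Set.finite_of_encard_le_coe (hfib y)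
  have := ht.to_subtype
  let e := Finite.equivFin (Fin (N + 1) × t)
  refine ⟨_, fun i => {x | e (κ x, τ x) = i}, ?_, fun i j hij => ?_, ?_, fun i => ?_⟩
  · exact Nat.one_le_iff_ne_zero.2 (Nat.ne_zero_of_lt (e (κ x₀, τ x₀)).2)
  · exact Set.disjoint_left.2 fun x h1 h2 => hij (h1.symm.trans h2)
  · exact Set.eq_univ_iff_forall.2 fun x => Set.mem_iUnion.2 ⟨_, rfl⟩
  · have hcol : ∀ x ∈ {x | e (κ x, τ x) = i}, ∀ x' ∈ {x | e (κ x, τ x) = i},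
        κ x = κ x' ∧ τ x = τ x' := fun x hx x' hx' =>
      Prod.ext_iff.1 (e.injective (Eq.trans hx (Eq.symm hx')))
    refine ⟨fun x => f x, fun x x' hxx => ?_, ?_⟩
    · exact Subtype.ext (hκ _ _ (hcol x x.2 x' x'.2).1 hxx)
    · exact isCoarseMap_of_le_entry hX hρ hcomp hft (show 0 < δ ^ 2 / 2 by positivity)
        fun x hx x' hx' => hτ x x' (hcol x hx x' hx').2

end UniformRoe

end

theorem theorem1p2 {X : Type*} {Y : Type*} [MetricSpace X] [MetricSpace Y]
    (hX : UniformRoe.UniformlyLocallyFinite X) (hY : UniformRoe.UniformlyLocallyFinite Y)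
    (hghost : UniformRoe.SparseSubspacesYieldOnlyCompactGhostProjections Y) :
    ((∃ f : X → Y, Function.Injective f ∧ UniformRoe.IsCoarseMap f) →
      ∃ Φ : UniformRoe.uniformRoeAlgebra X →⋆ₙₐ[ℂ] UniformRoe.uniformRoeAlgebra Y,
        Function.Injective Φ) ∧
    ((∃ Φ : UniformRoe.uniformRoeAlgebra X →⋆ₙₐ[ℂ] UniformRoe.uniformRoeAlgebra Y,
        Function.Injective Φ ∧ UniformRoe.CompactPreserving Φ) →
      ∃ (k : ℕ) (P : Fin k → Set X), 1 ≤ k ∧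
        Pairwise (fun i j => Disjoint (P i) (P j)) ∧ (⋃ i, P i) = Set.univ ∧
        ∀ i, ∃ f : P i → Y, Function.Injective f ∧ UniformRoe.IsCoarseMap f) :=
  ⟨fun ⟨_, hf, hc⟩ => UniformRoe.exists_embedding_of_injective_coarse hf hc,
    fun ⟨_, hΦ, hc⟩ => UniformRoe.exists_partition_of_compactPreserving hX hY hghost hΦ hc⟩
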